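/- Let $E$ be the figure-eight knot (the closure of the braid $\sigma_1\sigma_2^{-1}\sigma_1\sigma_2^{-1}$) and, for $N\ge 1$, let $J_N(E;t)$ be its colored Jones polynomial associated with the $N$-dimensional irreducible representation of $\mathfrak{sl}(2;\mathbb{C})$, normalized so that $J_N(\text{unknot};t)=1$. For real $r$ put $$G(r):=\limsup_{N\to\infty}\frac{\log\left|J_N\left(E;\exp(2\pi r\sqrt{-1}/N)\right)\right|}{N}\in[-\infty,\infty]\qquad(\log 0:=-\infty).$$ Then $G(1)$ is finite and $$\lim_{r\to1}\limsup_{N\to\infty}\frac{\log\left|J_N\left(E;\exp(2\pi r\sqrt{-1}/N)\right)\right|}{N}=\limsup_{N\to\infty}\frac{\log\left|J_N\left(E;\exp(2\pi\sqrt{-1}/N)\right)\right|}{N},$$ where $r\to1$ through real numbers $r\ne1$. That is, $G$ is continuous at $r=1$. -/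

import Mathlib

open Filter Topology

noncomputable section

namespace ColoredJones

/-- The symbol `{m} = t^(m/2) - t^(-m/2)`.  All powers of `t` with fractional exponents are
principal powers, so they are powers of one and the same fourth root of `t`. -/
def brace (t : ℂ) (m : ℕ) : ℂ :=
  t ^ ((m : ℂ) / 2) - t ^ (-(m : ℂ) / 2)

/-- The symmetric quantum binomial coefficient `{n}! / ({k}! {n - k}!)`, given by its Pascal
recursion so that it is a Laurent polynomial in `t^(1/2)` and makes sense at roots of unity. -/
def qbinom (t : ℂ) : ℕ → ℕ → ℂ
  | _, 0 => 1
  | 0, _ + 1 => 0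
  | n + 1, k + 1 =>
      t ^ (((k : ℂ) + 1) / 2) * qbinom t n (k + 1) +
        t ^ (-((n : ℂ) - (k : ℂ)) / 2) * qbinom t n k

/-- The quotient `{a + m}! / {a}! = {a + 1} {a + 2} ⋯ {a + m}`. -/
def braceRising (t : ℂ) (a m : ℕ) : ℂ :=
  ∏ s ∈ Finset.range m, brace t (a + s + 1)

/-- The weight `i - (N - 1) / 2` of the `i`-th basis vector of the `N`-dimensional irreducible
representation of quantum `sl(2)`, where `0 ≤ i < N`. -/
def weight (N i : ℕ) : ℂ :=
  (i : ℂ) - ((N : ℂ) - 1) / 2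

/-- The `R`-matrix of the `N`-dimensional irreducible representation `V` of quantum `sl(2)`,
as a matrix on the basis `e_i ⊗ e_j` of `V ⊗ V`.  Its entry at `((i, j), (k, l))` is, for
`l = i + m` and `k = j - m` with `m ≥ 0`,
`{l}! {N-1-k}! / ({i}! {m}! {N-1-j}!) * t ^ (wt(i) wt(j) - m (i - j) / 2 - m (m + 1) / 4)`,
and it is `0` otherwise. -/
def rMatrix (N : ℕ) (t : ℂ) : Matrix (Fin N × Fin N) (Fin N × Fin N) ℂ :=
  fun x y =>
    let i : ℕ := x.1
    let j : ℕ := x.2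
    let k : ℕ := y.1
    let l : ℕ := y.2
    let m : ℕ := l - i
    if i + j = k + l ∧ i ≤ l then
      qbinom t l m * braceRising t (N - 1 - j) m *
        t ^ (weight N i * weight N j - (m : ℂ) * ((i : ℂ) - (j : ℂ)) / 2
              - (m : ℂ) * ((m : ℂ) + 1) / 4)
    else 0

/-- The inverse of the `R`-matrix.  Its entry at `((i, j), (k, l))` is, for
`l = i - m` and `k = j + m` with `m ≥ 0`,
`(-1)^m {k}! {N-1-l}! / ({j}! {m}! {N-1-i}!)
  * t ^ (- wt(i) wt(j) - m (i - j) / 2 + m (m + 1) / 4)`,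
and it is `0` otherwise. -/
def rMatrixInv (N : ℕ) (t : ℂ) : Matrix (Fin N × Fin N) (Fin N × Fin N) ℂ :=
  fun x y =>
    let i : ℕ := x.1
    let j : ℕ := x.2
    let k : ℕ := y.1
    let l : ℕ := y.2
    let m : ℕ := i - l
    if i + j = k + l ∧ l ≤ i then
      (-1) ^ m * qbinom t k m * braceRising t (N - 1 - i) m *
        t ^ (-(weight N i * weight N j) - (m : ℂ) * ((i : ℂ) - (j : ℂ)) / 2
              + (m : ℂ) * ((m : ℂ) + 1) / 4)
    else 0

/-- A braid word on `n + 1` strands: the letter `(i, true)` is the Artin generator crossing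
the strands `i` and `i + 1` (counted from `0`), and `(i, false)` is its inverse. -/
abbrev BraidWord (n : ℕ) : Type := List (Fin n × Bool)

/-- The exponent sum (writhe) of a braid word. -/
def writhe {n : ℕ} (β : BraidWord n) : ℤ :=
  (β.map fun g => if g.2 then (1 : ℤ) else -1).sum

/-- The matrix on `V^{⊗(n+1)}` that acts by `A` on the tensor factors `i` and `i + 1` and by
the identity on all other factors. -/
def actAt {n N : ℕ} (A : Matrix (Fin N × Fin N) (Fin N × Fin N) ℂ) (i : Fin n) :
    Matrix (Fin (n + 1) → Fin N) (Fin (n + 1) → Fin N) ℂ :=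
  fun x y =>
    if ∀ p : Fin (n + 1), p ≠ i.castSucc → p ≠ i.succ → x p = y p then
      A (x i.castSucc, x i.succ) (y i.castSucc, y i.succ)
    else 0

/-- The representation of a braid word on `V^{⊗(n+1)}` given by the `R`-matrix. -/
def braidMatrix {n : ℕ} (N : ℕ) (t : ℂ) (β : BraidWord n) :
    Matrix (Fin (n + 1) → Fin N) (Fin (n + 1) → Fin N) ℂ :=
  (β.map fun g => actAt (if g.2 then rMatrix N t else rMatrixInv N t) g.1).prod

/-- The operator on `V` of the long knot obtained from a braid word by closing all strands but
the first: the partial quantum trace, with weights `t^{wt(i)}` on each closed strand, corrected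
by the framing factor `t^{-w (N^2 - 1) / 4}`, where `w` is the writhe. -/
def longKnotMatrix {n : ℕ} (N : ℕ) (t : ℂ) (β : BraidWord n) : Matrix (Fin N) (Fin N) ℂ :=
  fun a b =>
    t ^ (-(writhe β : ℂ) * ((N : ℂ) ^ 2 - 1) / 4) *
      ∑ c : Fin n → Fin N,
        braidMatrix N t β (Fin.cons a c) (Fin.cons b c) *
          ∏ p : Fin n, t ^ weight N (c p)

/-- The value at `t ≠ 0` of the `N`-colored Jones polynomial, normalized to be `1` for the
unknot, of the knot that is the closure of the braid word `β`.  The operator of the long knot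
is a scalar (it is an endomorphism of an irreducible representation), and the invariant is that
scalar, read off on the basis vector `e_0`.  The value for `N = 0` is irrelevant. -/
def coloredJones {n : ℕ} (N : ℕ) (β : BraidWord n) (t : ℂ) : ℂ :=
  if h : 0 < N then longKnotMatrix N t β ⟨0, h⟩ ⟨0, h⟩ else 0

/-- The figure-eight knot, as the closure of the three-strand braid
`σ₁ σ₂⁻¹ σ₁ σ₂⁻¹`. -/
def figureEight : BraidWord 2 :=
  [(0, true), (1, false), (0, true), (1, false)]

/-- The upper growth rate `limsup_N log |J_N(E; exp(2 π r √-1 / N))| / N` for the figure-eight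
knot `E`, as an extended real number, with `log 0 = -∞`. -/
def growthRate (r : ℝ) : EReal :=
  limsup
    (fun N : ℕ =>
      ENNReal.log ‖coloredJones N figureEight
          (Complex.exp (2 * (Real.pi : ℂ) * (r : ℂ) * Complex.I / (N : ℂ)))‖ₑ / (N : EReal))
    atTop

end ColoredJones

end

/-!
The operator of a long knot commutes with the raising operator of quantum `sl(2)`, so for generic
`t` it is a scalar, and the scalar may be read off the last basis vector, where the state sum
collapses, by `q`-binomial summation, to Habiro's cyclotomic expansion; continuity and density
extend this to every `t` in the slit plane.  At `t = exp (2 π r √-1 / N)` the expansion is a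
real sum of products of the factors `4 (sin² (π r k / N) - sin² (π r))`.  For `r` near `1`, split
the products at `k ≈ η N` and `k ≈ (1 - η) N`: the initial product is a common factor of
subexponential size, the remaining bulk ratios are within `1 ± κ` of those at `r = 1`, and the
tail decays geometrically.  The only obstruction to a lower bound is a factor that nearly
vanishes, which happens when `N |r - 1| / r` is close to an integer; it cannot happen for both
`N` and `N + 1`, and at `r = 1` the sum loses at most a constant factor from `N` to `N + 1`.
-/

noncomputable section

namespace ColoredJones

open Finset
open Finset.HasAntidiagonal (antidiagonal)
open scoped Kronecker

theorem inv_cpow_eq_cpow_neg {t : ℂ} (ht : t ∈ Complex.slitPlane) (z : ℂ) : t⁻¹ ^ z = t ^ (-z) := by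
  rw [Complex.inv_cpow _ _ (Complex.mem_slitPlane_iff_arg.mp ht).1, Complex.cpow_neg]

theorem brace_zero (t : ℂ) : brace t 0 = 0 := by simp [brace]

theorem brace_inv {t : ℂ} (ht : t ∈ Complex.slitPlane) (m : ℕ) : brace t⁻¹ m = -brace t m := by
  simp only [brace, inv_cpow_eq_cpow_neg ht, neg_div, neg_neg, neg_sub]

theorem brace_add {t : ℂ} (ht : t ≠ 0) (a b : ℕ) :
    brace t (a + b) = t ^ ((b : ℂ) / 2) * brace t a + t ^ (-(a : ℂ) / 2) * brace t b := by
  simp only [brace, mul_sub, ← Complex.cpow_add _ _ ht]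
  push_cast
  ring_nf

theorem brace_add_mul_brace_sub {t : ℂ} (ht : t ≠ 0) {a b : ℕ} (hab : b ≤ a) :
    brace t (a + b) * brace t (a - b) =
      t ^ (a : ℂ) + t ^ (-(a : ℂ)) - (t ^ (b : ℂ) + t ^ (-(b : ℂ))) := by
  simp only [brace, mul_sub, sub_mul, ← Complex.cpow_add _ _ ht]
  push_cast [hab]
  ring_nf

theorem braceRising_zero (t : ℂ) (a : ℕ) : braceRising t a 0 = 1 := prod_range_zero _

theorem braceRising_succ (t : ℂ) (a m : ℕ) :
    braceRising t a (m + 1) = braceRising t a m * brace t (a + m + 1) :=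
  prod_range_succ _ _

theorem braceRising_succ_left (t : ℂ) (a m : ℕ) :
    braceRising t a (m + 1) = brace t (a + 1) * braceRising t (a + 1) m := by
  simp only [braceRising, prod_range_succ', add_zero, mul_comm, ← add_assoc, add_right_comm]

theorem braceRising_inv {t : ℂ} (ht : t ∈ Complex.slitPlane) (a m : ℕ) :
    braceRising t⁻¹ a m = (-1) ^ m * braceRising t a m := by
  simp only [braceRising, brace_inv ht, prod_neg, card_range]

/-- The quantum factorial `{n}! = {1} {2} ⋯ {n}`. -/
def braceFactorial (t : ℂ) (n : ℕ) : ℂ := braceRising t 0 n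

theorem braceFactorial_zero (t : ℂ) : braceFactorial t 0 = 1 := braceRising_zero t 0

theorem braceFactorial_succ (t : ℂ) (n : ℕ) :
    braceFactorial t (n + 1) = braceFactorial t n * brace t (n + 1) := by
  simp only [braceFactorial, braceRising_succ, zero_add]

theorem braceFactorial_mul_braceRising (t : ℂ) (a m : ℕ) :
    braceFactorial t a * braceRising t a m = braceFactorial t (a + m) := by
  simp only [braceFactorial, braceRising, prod_range_add, zero_add]

theorem qbinom_zero_right (t : ℂ) (n : ℕ) : qbinom t n 0 = 1 := by cases n <;> rfl

theorem qbinom_succ_succ (t : ℂ) (n k : ℕ) :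
    qbinom t (n + 1) (k + 1) = t ^ (((k : ℂ) + 1) / 2) * qbinom t n (k + 1) +
      t ^ (-((n : ℂ) - (k : ℂ)) / 2) * qbinom t n k := rfl

theorem qbinom_of_lt (t : ℂ) {n k : ℕ} (h : n < k) : qbinom t n k = 0 := by
  induction n generalizing k with
  | zero => obtain ⟨k, rfl⟩ := Nat.exists_eq_add_one.mpr h; rfl
  | succ n ih =>
    obtain ⟨k, rfl⟩ := Nat.exists_eq_add_one.mpr (Nat.zero_lt_of_lt h)
    rw [qbinom_succ_succ, ih (by omega), ih (by omega), mul_zero, mul_zero, add_zero]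

theorem qbinom_self (t : ℂ) (n : ℕ) : qbinom t n n = 1 := by
  induction n with
  | zero => rfl
  | succ n ih => simp [qbinom_succ_succ, ih, qbinom_of_lt t n.lt_succ_self]

theorem sum_mul_qbinom_succ (t : ℂ) (u : ℕ → ℂ) (n : ℕ) :
    ∑ k ∈ range (n + 2), u k * qbinom t (n + 1) k =
      ∑ k ∈ range (n + 1),
        (t ^ ((k : ℂ) / 2) * u k + t ^ (-((n : ℂ) - k) / 2) * u (k + 1)) * qbinom t n k := by
  have hshift : ∑ k ∈ range (n + 1), t ^ ((k : ℂ) / 2) * u k * qbinom t n k =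
      ∑ k ∈ range (n + 1), t ^ (((k : ℂ) + 1) / 2) * u (k + 1) * qbinom t n (k + 1) + u 0 := by
    have htop := sum_range_succ (fun k : ℕ => t ^ ((k : ℂ) / 2) * u k * qbinom t n k) (n + 1)
    rw [qbinom_of_lt t n.lt_succ_self, mul_zero, add_zero, sum_range_succ'] at htop
    simpa [qbinom_zero_right] using htop.symm
  simp only [add_mul, sum_add_distrib, hshift]
  rw [sum_range_succ', qbinom_zero_right, mul_one, add_right_comm, ← sum_add_distrib]
  refine congrArg (· + u 0) (sum_congr rfl fun k _ => ?_)
  rw [qbinom_succ_succ]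
  ring

theorem qbinom_mul_braceFactorial {t : ℂ} (ht : t ≠ 0) (n k : ℕ) :
    qbinom t (n + k) k * (braceFactorial t n * braceFactorial t k) = braceFactorial t (n + k) := by
  induction n generalizing k with
  | zero => simp [braceFactorial_zero, qbinom_self]
  | succ n ihn =>
    induction k with
    | zero => simp [braceFactorial_zero, qbinom_zero_right]
    | succ k ihk =>
      have hn := ihn (k + 1)
      rw [braceFactorial_succ t k] at hn
      rw [braceFactorial_succ t n, show n + 1 + k = n + (k + 1) by ring] at ihk
      have hexp : -(((n + (k + 1) : ℕ) : ℂ) - k) / 2 = -((n + 1 : ℕ) : ℂ) / 2 := by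
        push_cast
        ring
      rw [show n + 1 + (k + 1) = n + (k + 1) + 1 by ring, qbinom_succ_succ, hexp,
        braceFactorial_succ t (n + (k + 1)), braceFactorial_succ t n, braceFactorial_succ t k,
        show n + (k + 1) + 1 = n + 1 + (k + 1) by ring, brace_add ht (n + 1) (k + 1)]
      push_cast at hn ihk ⊢
      linear_combination (t ^ (((k : ℂ) + 1) / 2) * brace t (n + 1)) * hn +
        (t ^ (-((n : ℂ) + 1) / 2) * brace t (k + 1)) * ihk

/-- The points `t` of the slit plane at which no quantum integer `{k}` with `k ≥ 1` vanishes, so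
that quotients of quantum factorials are honest quotients. Staying off the negative real axis
makes the principal powers of `t` and `t⁻¹` reciprocal to each other. -/
structure Generic (t : ℂ) : Prop where
  mem_slitPlane : t ∈ Complex.slitPlane
  brace_succ_ne_zero : ∀ k : ℕ, brace t (k + 1) ≠ 0

namespace Generic

variable {t : ℂ} (ht : Generic t)
include ht

theorem ne_zero : t ≠ 0 := Complex.slitPlane_ne_zero ht.mem_slitPlane

theorem inv : Generic t⁻¹ where
  mem_slitPlane := by
    obtain ⟨harg, hne⟩ := Complex.mem_slitPlane_iff_arg.mp ht.mem_slitPlane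
    refine Complex.mem_slitPlane_iff_arg.mpr ⟨?_, inv_ne_zero hne⟩
    have hlt := Complex.neg_pi_lt_arg t
    rw [Complex.arg_inv, if_neg harg]
    exact fun h => by linarith
  brace_succ_ne_zero k := by
    rw [brace_inv ht.mem_slitPlane]
    exact neg_ne_zero.mpr (ht.brace_succ_ne_zero k)

theorem braceFactorial_ne_zero (n : ℕ) : braceFactorial t n ≠ 0 := by
  rw [braceFactorial, braceRising, prod_ne_zero_iff]
  exact fun s _ => ht.brace_succ_ne_zero (0 + s)

theorem braceRising_eq_div (a m : ℕ) :
    braceRising t a m = braceFactorial t (a + m) / braceFactorial t a :=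
  eq_div_of_mul_eq (ht.braceFactorial_ne_zero a)
    (by rw [mul_comm, braceFactorial_mul_braceRising])

theorem qbinom_add_right (n k : ℕ) :
    qbinom t (n + k) k = braceFactorial t (n + k) / (braceFactorial t n * braceFactorial t k) :=
  eq_div_of_mul_eq (mul_ne_zero (ht.braceFactorial_ne_zero n) (ht.braceFactorial_ne_zero k))
    (qbinom_mul_braceFactorial ht.ne_zero n k)

theorem brace_mul_qbinom_succ (n k : ℕ) :
    brace t (k + 1) * qbinom t (n + (k + 1)) (k + 1) =
      brace t (n + k + 1) * qbinom t (n + k) k := by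
  rw [ht.qbinom_add_right, ht.qbinom_add_right, ← add_assoc, braceFactorial_succ,
    braceFactorial_succ t k]
  have hk := ht.brace_succ_ne_zero k
  field_simp

theorem brace_mul_qbinom_succ' (n k : ℕ) :
    brace t (k + 1) * qbinom t (n + (k + 1)) (k + 1) =
      brace t (n + 1) * qbinom t (n + (k + 1)) k := by
  rw [ht.qbinom_add_right, show n + (k + 1) = n + 1 + k by ring, ht.qbinom_add_right,
    braceFactorial_succ t k, braceFactorial_succ t n]
  have hk := ht.brace_succ_ne_zero k
  have hn := ht.brace_succ_ne_zero n
  field_simp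

theorem qbinom_inv (n k : ℕ) : qbinom t⁻¹ n k = qbinom t n k := by
  rcases lt_or_ge n k with hnk | hnk
  · rw [qbinom_of_lt _ hnk, qbinom_of_lt _ hnk]
  · obtain ⟨d, rfl⟩ := Nat.exists_eq_add_of_le' hnk
    have hfac := ht.braceFactorial_ne_zero
    rw [ht.qbinom_add_right, ht.inv.qbinom_add_right]
    simp only [braceFactorial, braceRising_inv ht.mem_slitPlane, pow_add] at hfac ⊢
    rw [mul_mul_mul_comm ((-1) ^ d), mul_div_mul_left _ _ (by simp)]

theorem sum_mul_qbinom_succ' (u : ℕ → ℂ) (n : ℕ) :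
    ∑ k ∈ range (n + 2), u k * qbinom t (n + 1) k =
      ∑ k ∈ range (n + 1),
        (t ^ (-(k : ℂ) / 2) * u k + t ^ (((n : ℂ) - k) / 2) * u (k + 1)) * qbinom t n k := by
  simpa only [ht.qbinom_inv, inv_cpow_eq_cpow_neg ht.mem_slitPlane, neg_div, neg_neg]
    using sum_mul_qbinom_succ t⁻¹ u n

end Generic

theorem braceRising_eq_sum_qbinom {t : ℂ} (ht : t ≠ 0) (a m : ℕ) :
    braceRising t a m = ∑ k ∈ range (m + 1),
      (-1) ^ (m - k) * t ^ ((2 * (k : ℂ) - m) * (2 * a + m + 1) / 4) * qbinom t m k := by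
  induction m generalizing a with
  | zero => simp [braceRising_zero, qbinom_zero_right]
  | succ m ih =>
    rw [sum_mul_qbinom_succ, braceRising_succ_left, ih, mul_sum]
    refine sum_congr rfl fun k hk => ?_
    have hkm : k ≤ m := by simpa [Nat.lt_succ_iff] using hk
    rw [Nat.succ_sub hkm, Nat.add_sub_add_right, pow_succ, ← mul_assoc]
    congr 1
    rw [mul_left_comm, mul_left_comm _ (_ * _), mul_left_comm _ ((-1 : ℂ) ^ (m - k)), mul_assoc,
      ← mul_add]
    congr 1
    simp only [brace, sub_mul, neg_one_mul, neg_add_eq_sub, ← Complex.cpow_add _ _ ht]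
    push_cast
    ring_nf

theorem Generic.sum_qbinom_mul_braceRising {t : ℂ} (ht : Generic t) (n k : ℕ) :
    ∑ a ∈ range (n + 1), (-1) ^ a * braceRising t k a *
      t ^ ((n : ℂ) * (k + 1) + n * a / 2 - k * a / 2 - (a : ℂ) ^ 2 / 4 - 3 * a / 4) *
        qbinom t n a = 1 := by
  induction n generalizing k with
  | zero => simp [qbinom_zero_right, braceRising_zero]
  | succ n ih =>
    rw [ht.sum_mul_qbinom_succ' fun a => _]
    have hsplit := congrArg₂ (fun x y => t ^ ((k : ℂ) + 1) * x + (1 - t ^ ((k : ℂ) + 1)) * y)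
      (ih k) (ih (k + 1))
    rw [mul_sum, mul_sum, ← sum_add_distrib] at hsplit
    refine Eq.trans (sum_congr rfl fun a _ => ?_) (hsplit.trans (by ring))
    have hkeep : t ^ (-(a : ℂ) / 2) * t ^ (((n + 1 : ℕ) : ℂ) * (k + 1) + (n + 1 : ℕ) * a / 2 -
          k * a / 2 - (a : ℂ) ^ 2 / 4 - 3 * a / 4) = t ^ ((k : ℂ) + 1) *
        t ^ ((n : ℂ) * (k + 1) + n * a / 2 - k * a / 2 - (a : ℂ) ^ 2 / 4 - 3 * a / 4) := by
      simp only [← Complex.cpow_add _ _ ht.ne_zero]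
      push_cast
      ring_nf
    have hdrop : -(t ^ (((n : ℂ) - a) / 2) * brace t (k + 1) *
          t ^ (((n + 1 : ℕ) : ℂ) * (k + 1) + (n + 1 : ℕ) * (a + 1 : ℕ) / 2 -
            k * (a + 1 : ℕ) / 2 - ((a + 1 : ℕ) : ℂ) ^ 2 / 4 - 3 * (a + 1 : ℕ) / 4)) =
        (1 - t ^ ((k : ℂ) + 1)) * t ^ ((n : ℂ) * ((k + 1 : ℕ) + 1) + n * a / 2 -
          (k + 1 : ℕ) * a / 2 - (a : ℂ) ^ 2 / 4 - 3 * a / 4) := by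
      simp only [brace, mul_sub, sub_mul, one_mul, ← Complex.cpow_add _ _ ht.ne_zero]
      push_cast
      ring_nf
    rw [braceRising_succ_left, pow_succ (-1 : ℂ) a]
    linear_combination ((-1) ^ a * qbinom t n a) *
      (braceRising t k a * hkeep + braceRising t (k + 1) a * hdrop)

/-- The raising operator of the `N`-dimensional representation, acting on row vectors. -/
def raiseMatrix (N : ℕ) (t : ℂ) : Matrix (Fin N) (Fin N) ℂ :=
  fun i j => if (j : ℕ) = i + 1 then brace t (i + 1) else 0

/-- The Cartan element `t^{wt/2}` in the `N`-dimensional representation. -/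
def cartan (N : ℕ) (t : ℂ) : Matrix (Fin N) (Fin N) ℂ :=
  Matrix.diagonal fun i => t ^ (weight N i / 2)

/-- The inverse `t^{-wt/2}` of the Cartan element. -/
def cartanInv (N : ℕ) (t : ℂ) : Matrix (Fin N) (Fin N) ℂ :=
  Matrix.diagonal fun i => t ^ (-weight N i / 2)

/-- The action of the raising operator on the tensor square of the representation, through the
coproduct. -/
def raiseCoprod (N : ℕ) (t : ℂ) : Matrix (Fin N × Fin N) (Fin N × Fin N) ℂ :=
  raiseMatrix N t ⊗ₖ cartan N t + cartanInv N t ⊗ₖ raiseMatrix N t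

theorem mul_raiseMatrix_apply_succ {m : Type*} {N : ℕ} (t : ℂ) (X : Matrix m (Fin N) ℂ) (a : m)
    {j : ℕ} (hj : j + 1 < N) :
    (X * raiseMatrix N t) a ⟨j + 1, hj⟩ = X a ⟨j, j.lt_succ_self.trans hj⟩ * brace t (j + 1) := by
  rw [Matrix.mul_apply, sum_eq_single ⟨j, j.lt_succ_self.trans hj⟩ _ (by simp)]
  · simp [raiseMatrix]
  · intro z _ hz
    rw [raiseMatrix, if_neg fun h => hz (Fin.ext (Nat.succ_injective h).symm), mul_zero]

theorem raiseMatrix_mul_apply {m : Type*} {N : ℕ} (t : ℂ) (X : Matrix (Fin N) m ℂ) (i : Fin N)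
    (b : m) : (raiseMatrix N t * X) i b =
      if h : (i : ℕ) + 1 < N then brace t (i + 1) * X ⟨i + 1, h⟩ b else 0 := by
  rw [Matrix.mul_apply]
  split_ifs with h
  · rw [sum_eq_single ⟨i + 1, h⟩ _ (by simp)]
    · simp [raiseMatrix]
    · intro z _ hz
      rw [raiseMatrix, if_neg fun h => hz (Fin.ext h), zero_mul]
  · refine sum_eq_zero fun z _ => ?_
    rw [raiseMatrix, if_neg (by omega), zero_mul]

theorem sum_mul_raiseMatrix (N : ℕ) (t : ℂ) (g : ℕ → ℂ) (j : Fin N) :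
    ∑ z : Fin N, g z * raiseMatrix N t z j = g (j - 1) * brace t j := by
  obtain ⟨_ | j, hj⟩ := j
  · simp [raiseMatrix, brace_zero]
  · exact mul_raiseMatrix_apply_succ t (fun (_ : Unit) z => g z) () hj

theorem sum_raiseMatrix_mul (N : ℕ) (t : ℂ) (g : ℕ → ℂ) (i : Fin N) :
    ∑ z : Fin N, raiseMatrix N t i z * g z =
      if (i : ℕ) + 1 < N then brace t (i + 1) * g (i + 1) else 0 :=
  raiseMatrix_mul_apply t (fun z (_ : Unit) => g z) i ()

theorem mul_raiseCoprod_apply {N : ℕ} (t : ℂ) {A : Matrix (Fin N × Fin N) (Fin N × Fin N) ℂ}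
    {r : ℕ → ℕ → ℕ → ℕ → ℂ} (hA : ∀ x y, A x y = r x.1 x.2 y.1 y.2) (i j k l : Fin N) :
    (A * raiseCoprod N t) (i, j) (k, l) =
      r i j (k - 1) l * brace t k * t ^ (weight N l / 2) +
      r i j k (l - 1) * brace t l * t ^ (-weight N k / 2) := by
  simp only [Matrix.mul_apply, raiseCoprod, Matrix.add_apply, Matrix.kroneckerMap_apply, mul_add,
    sum_add_distrib, Fintype.sum_prod_type, hA, cartan, cartanInv, Matrix.diagonal_apply,
    mul_ite, ite_mul, mul_zero, zero_mul, sum_ite_eq', mem_univ, if_true, ← mul_assoc]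
  rw [sum_comm (s := univ) (t := univ) (f := fun x y => if x = k then _ else _)]
  simp only [sum_ite_eq', mem_univ, if_true]
  rw [← sum_mul_raiseMatrix N t fun z => r i j z l, ← sum_mul_raiseMatrix N t fun z => r i j k z,
    sum_mul, sum_mul]
  exact congrArg₂ (· + ·) rfl (sum_congr rfl fun z _ => mul_right_comm _ _ _)

theorem raiseCoprod_mul_apply {N : ℕ} (t : ℂ) {A : Matrix (Fin N × Fin N) (Fin N × Fin N) ℂ}
    {r : ℕ → ℕ → ℕ → ℕ → ℂ} (hA : ∀ x y, A x y = r x.1 x.2 y.1 y.2) (i j k l : Fin N) :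
    (raiseCoprod N t * A) (i, j) (k, l) =
      (if (i : ℕ) + 1 < N then brace t (i + 1) * r (i + 1) j k l else 0) * t ^ (weight N j / 2) +
      (if (j : ℕ) + 1 < N then brace t (j + 1) * r i (j + 1) k l else 0) *
        t ^ (-weight N i / 2) := by
  rw [← sum_raiseMatrix_mul N t fun z => r z j k l, ← sum_raiseMatrix_mul N t fun z => r i z k l,
    sum_mul, sum_mul]
  simp only [Matrix.mul_apply, raiseCoprod, Matrix.add_apply, Matrix.kroneckerMap_apply, add_mul,
    sum_add_distrib, Fintype.sum_prod_type, hA, cartan, cartanInv, Matrix.diagonal_apply,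
    mul_ite, ite_mul, mul_zero, zero_mul, sum_ite_eq, mem_univ, if_true]
  rw [sum_comm (s := univ) (t := univ) (f := fun x y => if i = x then _ else _)]
  simp only [sum_ite_eq, mem_univ, if_true]
  exact congrArg₂ (· + ·) (sum_congr rfl fun z _ => mul_right_comm _ _ _)
    (sum_congr rfl fun z _ => by ring)

/-- The exponent of `t` in the entry of the `R`-matrix at `((i, j), (j - m, i + m))`. -/
def rExponent (N i j m : ℕ) : ℂ :=
  weight N i * weight N j - (m : ℂ) * ((i : ℂ) - (j : ℂ)) / 2 - (m : ℂ) * ((m : ℂ) + 1) / 4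

/-- The entry of the `R`-matrix at `((i, j), (k, l))`, as a function of natural numbers. -/
def rEntry (N : ℕ) (t : ℂ) (i j k l : ℕ) : ℂ :=
  if i + j = k + l ∧ i ≤ l then
    qbinom t l (l - i) * braceRising t (N - 1 - j) (l - i) * t ^ rExponent N i j (l - i)
  else 0

theorem rMatrix_apply (N : ℕ) (t : ℂ) (x y : Fin N × Fin N) :
    rMatrix N t x y = rEntry N t x.1 x.2 y.1 y.2 := rfl

theorem rEntry_of_not {N : ℕ} {t : ℂ} {i j k l : ℕ} (h : ¬ (i + j = k + l ∧ i ≤ l)) :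
    rEntry N t i j k l = 0 := if_neg h

theorem rEntry_add (N : ℕ) (t : ℂ) (i k m : ℕ) :
    rEntry N t i (k + m) k (i + m) =
      qbinom t (i + m) m * braceRising t (N - 1 - (k + m)) m * t ^ rExponent N i (k + m) m := by
  rw [rEntry, if_pos ⟨by ring, by omega⟩, Nat.add_sub_cancel_left]

theorem rEntry_self (N : ℕ) (t : ℂ) (i j : ℕ) :
    rEntry N t i j j i = t ^ (weight N i * weight N j) := by
  simpa [rExponent, qbinom_zero_right, braceRising_zero] using rEntry_add N t i j 0

theorem rEntry_raise_zero {t : ℂ} (ht : t ≠ 0) (N i j : ℕ) :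
    rEntry N t i j j i * brace t (j + 1) * t ^ (weight N i / 2) =
      brace t (j + 1) * rEntry N t i (j + 1) (j + 1) i * t ^ (-weight N i / 2) := by
  rw [rEntry_self, rEntry_self, mul_right_comm, mul_comm, mul_assoc (brace t (j + 1)),
    ← Complex.cpow_add _ _ ht, ← Complex.cpow_add _ _ ht]
  simp only [weight]
  push_cast
  ring_nf

theorem cpow_rExponent_raise {t : ℂ} (ht : t ≠ 0) {N n i k m : ℕ} (hN : N = n + 1 + (k + m)) :
    t ^ rExponent N i (k + m) (m + 1) * brace t (n + m + 1) * brace t k *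
        t ^ (weight N (i + (m + 1)) / 2) +
      brace t (m + 1) * t ^ rExponent N i (k + m) m * t ^ (-weight N k / 2) =
    brace t (m + 1) * t ^ rExponent N (i + 1) (k + m) m * t ^ (weight N (k + m) / 2) +
      brace t (k + m + 1) * brace t n * t ^ rExponent N i (k + m + 1) (m + 1) *
        t ^ (-weight N i / 2) := by
  simp only [brace, mul_sub, sub_mul, ← Complex.cpow_add _ _ ht, rExponent, weight, hN]
  push_cast
  ring_nf

theorem rEntry_raise_succ {t : ℂ} (ht : Generic t) {N : ℕ} (i k m : ℕ) (hN : k + m < N) :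
    rEntry N t i (k + m) (k - 1) (i + (m + 1)) * brace t k * t ^ (weight N (i + (m + 1)) / 2) +
      rEntry N t i (k + m) k (i + m) * brace t (i + (m + 1)) * t ^ (-weight N k / 2) =
    brace t (i + 1) * rEntry N t (i + 1) (k + m) k (i + (m + 1)) * t ^ (weight N (k + m) / 2) +
      (if k + m + 1 < N then brace t (k + m + 1) * rEntry N t i (k + m + 1) k (i + (m + 1))
        else 0) * t ^ (-weight N i / 2) := by
  obtain ⟨n, hn⟩ : ∃ n, N = n + 1 + (k + m) := ⟨N - 1 - (k + m), by omega⟩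
  have hcodim : N - 1 - (k + m) = n := by omega
  have hlower : rEntry N t i (k + m) (k - 1) (i + (m + 1)) * brace t k =
      qbinom t (i + (m + 1)) (m + 1) * (braceRising t n m * brace t (n + m + 1)) *
        t ^ rExponent N i (k + m) (m + 1) * brace t k := by
    rcases k with _ | k
    · simp [brace_zero]
    · have := rEntry_add N t i k (m + 1)
      rw [show k + (m + 1) = k + 1 + m by ring, hcodim, braceRising_succ] at this
      rw [Nat.add_sub_cancel, this]
  have hupper : (if k + m + 1 < N then brace t (k + m + 1) *
      rEntry N t i (k + m + 1) k (i + (m + 1)) else 0) = brace t (k + m + 1) *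
        (qbinom t (i + (m + 1)) (m + 1) * (brace t n * braceRising t n m) *
          t ^ rExponent N i (k + m + 1) (m + 1)) := by
    rcases n with _ | n
    · rw [if_neg (by omega)]
      simp [brace_zero]
    · have := rEntry_add N t i k (m + 1)
      rw [show N - 1 - (k + (m + 1)) = n by omega, ← add_assoc] at this
      rw [if_pos (by omega), this, braceRising_succ_left]
  have hleft := ht.brace_mul_qbinom_succ i m
  have hright := ht.brace_mul_qbinom_succ' i m
  rw [hlower, hupper, rEntry_add, show i + (m + 1) = i + 1 + m by ring, rEntry_add, hcodim,
    show i + 1 + m = i + (m + 1) by ring]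
  rw [show i + m + 1 = i + (m + 1) by ring] at hleft
  linear_combination
    qbinom t (i + (m + 1)) (m + 1) * braceRising t n m *
      cpow_rExponent_raise ht.ne_zero (i := i) hn -
    braceRising t n m * t ^ rExponent N i (k + m) m * t ^ (-weight N k / 2) * hleft +
    braceRising t n m * t ^ rExponent N (i + 1) (k + m) m * t ^ (weight N (k + m) / 2) * hright

theorem commute_rMatrix_raiseCoprod {t : ℂ} (ht : Generic t) (N : ℕ) :
    Commute (rMatrix N t) (raiseCoprod N t) := by
  ext ⟨⟨i, hi⟩, ⟨j, hj⟩⟩ ⟨⟨k, hk⟩, ⟨l, hl⟩⟩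
  rw [mul_raiseCoprod_apply t (rMatrix_apply N t), raiseCoprod_mul_apply t (rMatrix_apply N t)]
  dsimp only
  by_cases hdeg : i + j + 1 = k + l ∧ i < l
  · obtain ⟨hsum, hil⟩ := hdeg
    obtain ⟨m, rfl⟩ := Nat.exists_eq_add_of_lt hil
    obtain rfl : j = k + m := by omega
    rw [if_pos (by omega), add_assoc i m 1, ← rEntry_raise_succ ht i k m hj, ← add_assoc,
      Nat.add_sub_cancel]
  have hkeep : rEntry N t i j k (l - 1) * brace t l = 0 := by
    rcases l with _ | l
    · simp [brace_zero]
    · rw [rEntry_of_not (by omega), zero_mul]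
  rw [hkeep, rEntry_of_not (i := i + 1) (by omega), mul_zero, ite_self, zero_mul, zero_mul,
    add_zero, zero_add]
  by_cases hdiag : k = j + 1 ∧ l = i
  · obtain ⟨rfl, rfl⟩ := hdiag
    rw [if_pos hk, Nat.add_sub_cancel, rEntry_raise_zero ht.ne_zero]
  · rw [rEntry_of_not (j := j + 1) (by omega), mul_zero, ite_self, zero_mul]
    rcases k with _ | k
    · simp [brace_zero]
    · rw [rEntry_of_not (by omega), zero_mul, zero_mul]

theorem Generic.rMatrixInv_eq_submatrix_swap {t : ℂ} (ht : Generic t) (N : ℕ) :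
    rMatrixInv N t = (rMatrix N t⁻¹).submatrix Prod.swap Prod.swap := by
  ext ⟨i, j⟩ ⟨k, l⟩
  simp only [rMatrixInv, rMatrix, Matrix.submatrix_apply, Prod.fst_swap, Prod.snd_swap,
    add_comm (j : ℕ), add_comm (l : ℕ)]
  by_cases h : (i : ℕ) + j = k + l ∧ (l : ℕ) ≤ i
  · rw [if_pos h, if_pos ⟨h.1, by omega⟩, show (k : ℕ) - j = i - l by omega, ht.qbinom_inv,
      braceRising_inv ht.mem_slitPlane, inv_cpow_eq_cpow_neg ht.mem_slitPlane]
    ring_nf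
  · rw [if_neg h, if_neg (by omega)]

theorem raiseCoprod_inv {t : ℂ} (ht : t ∈ Complex.slitPlane) (N : ℕ) :
    raiseCoprod N t⁻¹ = -(raiseCoprod N t).submatrix Prod.swap Prod.swap := by
  have hraise : raiseMatrix N t⁻¹ = -raiseMatrix N t := by
    ext i j
    simp only [raiseMatrix, brace_inv ht, Matrix.neg_apply]
    split_ifs <;> simp
  have hcartan : cartan N t⁻¹ = cartanInv N t := by
    simp only [cartan, cartanInv, inv_cpow_eq_cpow_neg ht, neg_div]
  have hcartanInv : cartanInv N t⁻¹ = cartan N t := by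
    simp only [cartan, cartanInv, inv_cpow_eq_cpow_neg ht, neg_div, neg_neg]
  ext ⟨i, j⟩ ⟨k, l⟩
  simp only [raiseCoprod, hraise, hcartan, hcartanInv, Matrix.add_apply, Matrix.neg_apply,
    Matrix.kroneckerMap_apply, Matrix.submatrix_apply, Prod.swap]
  ring

theorem commute_rMatrixInv_raiseCoprod {t : ℂ} (ht : Generic t) (N : ℕ) :
    Commute (rMatrixInv N t) (raiseCoprod N t) := by
  have hinv := commute_rMatrix_raiseCoprod ht.inv N
  rw [raiseCoprod_inv ht.mem_slitPlane, Commute.neg_right_iff] at hinv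
  have hswap := congrArg (Matrix.submatrix · Prod.swap Prod.swap) hinv.eq
  rw [← Matrix.submatrix_mul_equiv _ _ _ (Equiv.prodComm _ _),
    ← Matrix.submatrix_mul_equiv _ _ _ (Equiv.prodComm _ _)] at hswap
  rw [ht.rMatrixInv_eq_submatrix_swap]
  exact hswap

/-- The partial trace over the second tensor factor, in which the `c`-th diagonal entry is
weighted by `u c`. -/
def partialTrace {R m n : Type*} [Semiring R] [Fintype n] (u : n → R)
    (B : Matrix (m × n) (m × n) R) : Matrix m m R :=
  fun a b => ∑ c, B (a, c) (b, c) * u c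

section PartialTrace

theorem partialTrace_add {R m n : Type*} [Semiring R] [Fintype n] (u : n → R)
    (A B : Matrix (m × n) (m × n) R) :
    partialTrace u (A + B) = partialTrace u A + partialTrace u B := by
  ext a b
  simp only [partialTrace, Matrix.add_apply, add_mul, sum_add_distrib]

variable {R m n : Type*} [CommSemiring R] [Fintype m] [Fintype n]

theorem partialTrace_mul_diagonal_kronecker [DecidableEq m] {B : Matrix (m × n) (m × n) R}
    {E : Matrix n n R} {d : m → R} {v : n → R}
    (h : ∀ a b c c', E c' c ≠ 0 → B (a, c) (b, c') ≠ 0 → d b * v c = d a * v c') :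
    partialTrace v (B * (Matrix.diagonal d ⊗ₖ E)) =
      partialTrace v ((Matrix.diagonal d ⊗ₖ E) * B) := by
  ext a b
  simp only [partialTrace, Matrix.mul_apply, Fintype.sum_prod_type_right, Matrix.kroneckerMap_apply,
    Matrix.diagonal_apply, mul_ite, ite_mul, mul_zero, zero_mul, sum_ite_eq, sum_ite_eq', mem_univ,
    if_true, sum_mul]
  rw [sum_comm]
  refine sum_congr rfl fun c' _ => sum_congr rfl fun c _ => ?_
  by_cases hE : E c' c = 0
  · simp [hE]
  by_cases hB : B (a, c) (b, c') = 0
  · simp [hB]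
  calc B (a, c) (b, c') * (d b * E c' c) * v c = B (a, c) (b, c') * E c' c * (d b * v c) := by ring
    _ = d a * E c' c * B (a, c) (b, c') * v c' := by
      rw [h a b c c' hE hB]
      ring

variable [DecidableEq n]

theorem partialTrace_mul_kronecker_diagonal (B : Matrix (m × n) (m × n) R) (E : Matrix m m R)
    (u v : n → R) :
    partialTrace v (B * (E ⊗ₖ Matrix.diagonal u)) = partialTrace (fun c => u c * v c) B * E := by
  ext a b
  simp only [partialTrace, Matrix.mul_apply, Fintype.sum_prod_type, Matrix.kroneckerMap_apply,
    Matrix.diagonal_apply, mul_ite, mul_zero, sum_ite_eq', mem_univ, if_true, sum_mul]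
  rw [sum_comm]
  exact sum_congr rfl fun x _ => sum_congr rfl fun c _ => by ring

theorem partialTrace_kronecker_diagonal_mul (B : Matrix (m × n) (m × n) R) (E : Matrix m m R)
    (u v : n → R) :
    partialTrace v ((E ⊗ₖ Matrix.diagonal u) * B) = E * partialTrace (fun c => u c * v c) B := by
  ext a b
  simp only [partialTrace, Matrix.mul_apply, Fintype.sum_prod_type, Matrix.kroneckerMap_apply,
    Matrix.diagonal_apply, mul_ite, ite_mul, mul_zero, zero_mul, sum_ite_eq, mem_univ, if_true,
    sum_mul, mul_sum]
  rw [sum_comm]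
  exact sum_congr rfl fun x _ => sum_congr rfl fun c _ => by ring

theorem commute_partialTrace [IsRightCancelAdd R] [DecidableEq m] {B : Matrix (m × n) (m × n) R}
    {E : Matrix m m R} {F : Matrix n n R} {d : m → R} {u v : n → R}
    (hB : Commute B (E ⊗ₖ Matrix.diagonal u + Matrix.diagonal d ⊗ₖ F))
    (h : ∀ a b c c', F c' c ≠ 0 → B (a, c) (b, c') ≠ 0 → d b * v c = d a * v c') :
    Commute (partialTrace (fun c => u c * v c) B) E := by
  have htrace := congrArg (partialTrace v) hB.eq
  rw [mul_add, add_mul, partialTrace_add, partialTrace_add, partialTrace_mul_kronecker_diagonal,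
    partialTrace_kronecker_diagonal_mul, partialTrace_mul_diagonal_kronecker h] at htrace
  exact add_right_cancel htrace

end PartialTrace

/-- A matrix `B` is graded with respect to the degree `w` of the basis vectors if it preserves
the degree. -/
def Graded {R m ι : Type*} [Zero R] (w : m → ι) (B : Matrix m m R) : Prop :=
  ∀ x y, B x y ≠ 0 → w x = w y

namespace Graded

variable {R m n ι : Type*} [Semiring R] {w : m → ι} {A B : Matrix m m R}

theorem mul [Fintype m] (hA : Graded w A) (hB : Graded w B) : Graded w (A * B) := by
  intro x y h
  obtain ⟨z, -, hz⟩ := exists_ne_zero_of_sum_ne_zero h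
  exact (hA x z (left_ne_zero_of_mul hz)).trans (hB z y (right_ne_zero_of_mul hz))

theorem commute_diagonal {S : Type*} [CommSemiring S] [Fintype m] [DecidableEq m]
    {B : Matrix m m S} (hB : Graded w B) {f : m → S} (hf : ∀ x y, w x = w y → f x = f y) :
    Commute B (Matrix.diagonal f) := by
  ext x y
  rw [Matrix.mul_diagonal, Matrix.diagonal_mul]
  by_cases h : B x y = 0
  · rw [h, zero_mul, mul_zero]
  · rw [hf x y (hB x y h), mul_comm]

theorem submatrix {l : Type*} (hA : Graded w A) (e : l → m) :
    Graded (w ∘ e) (A.submatrix e e) :=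
  fun x y => hA (e x) (e y)

variable [Add ι] {v : n → ι}

theorem partialTrace [IsRightCancelAdd ι] [Fintype n] {B : Matrix (m × n) (m × n) R}
    (hB : Graded (fun x => w x.1 + v x.2) B) (u : n → R) : Graded w (partialTrace u B) := by
  intro x y h
  obtain ⟨z, -, hz⟩ := exists_ne_zero_of_sum_ne_zero h
  exact add_right_cancel (hB _ _ (left_ne_zero_of_mul hz))

theorem kronecker {B : Matrix n n R} (hA : Graded w A) (hB : Graded v B) :
    Graded (fun x => w x.1 + v x.2) (A ⊗ₖ B) := fun _ _ h =>
  congrArg₂ (· + ·) (hA _ _ (left_ne_zero_of_mul h)) (hB _ _ (right_ne_zero_of_mul h))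

end Graded

theorem graded_one {R m ι : Type*} [Semiring R] [DecidableEq m] (w : m → ι) :
    Graded w (1 : Matrix m m R) := by
  intro x y h
  rw [of_not_not (mt Matrix.one_apply_ne h)]

/-- The degree on `V ⊗ V`, which is the weight up to a shift. -/
def grade₂ (N : ℕ) (x : Fin N × Fin N) : ℕ := x.1 + x.2

/-- The degree on `V ⊗ V ⊗ V`, which is the weight up to a shift. -/
def grade₃ (N : ℕ) (x : (Fin N × Fin N) × Fin N) : ℕ := grade₂ N x.1 + x.2

theorem rMatrix_ne_zero {N : ℕ} {t : ℂ} {x y : Fin N × Fin N} (h : rMatrix N t x y ≠ 0) :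
    (x.1 + x.2 : ℕ) = y.1 + y.2 ∧ (x.1 : ℕ) ≤ y.2 :=
  of_not_not fun h' => h (if_neg h')

theorem rMatrixInv_ne_zero {N : ℕ} {t : ℂ} {x y : Fin N × Fin N} (h : rMatrixInv N t x y ≠ 0) :
    (x.1 + x.2 : ℕ) = y.1 + y.2 ∧ (y.2 : ℕ) ≤ x.1 :=
  of_not_not fun h' => h (if_neg h')

theorem graded_rMatrix (N : ℕ) (t : ℂ) : Graded (grade₂ N) (rMatrix N t) :=
  fun _ _ h => (rMatrix_ne_zero h).1

theorem graded_rMatrixInv (N : ℕ) (t : ℂ) : Graded (grade₂ N) (rMatrixInv N t) :=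
  fun _ _ h => (rMatrixInv_ne_zero h).1

/-- The action of the raising operator on the tensor cube of the representation, through the
iterated coproduct. -/
def raiseCoprod₃ (N : ℕ) (t : ℂ) :
    Matrix ((Fin N × Fin N) × Fin N) ((Fin N × Fin N) × Fin N) ℂ :=
  raiseCoprod N t ⊗ₖ cartan N t + (cartanInv N t ⊗ₖ cartanInv N t) ⊗ₖ raiseMatrix N t

/-- The action of `A` on the first two factors of `V ⊗ V ⊗ V`. -/
def actLeft {N : ℕ} (A : Matrix (Fin N × Fin N) (Fin N × Fin N) ℂ) :
    Matrix ((Fin N × Fin N) × Fin N) ((Fin N × Fin N) × Fin N) ℂ :=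
  A ⊗ₖ (1 : Matrix (Fin N) (Fin N) ℂ)

/-- The action of `A` on the last two factors of `V ⊗ V ⊗ V`. -/
def actRight {N : ℕ} (A : Matrix (Fin N × Fin N) (Fin N × Fin N) ℂ) :
    Matrix ((Fin N × Fin N) × Fin N) ((Fin N × Fin N) × Fin N) ℂ :=
  ((1 : Matrix (Fin N) (Fin N) ℂ) ⊗ₖ A).submatrix (Equiv.prodAssoc _ _ _) (Equiv.prodAssoc _ _ _)

section TensorCube

variable {N : ℕ} {t : ℂ} {A : Matrix (Fin N × Fin N) (Fin N × Fin N) ℂ}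

theorem Graded.actLeft (hA : Graded (grade₂ N) A) : Graded (grade₃ N) (actLeft A) :=
  hA.kronecker (graded_one fun c : Fin N => (c : ℕ))

theorem Graded.actRight (hA : Graded (grade₂ N) A) : Graded (grade₃ N) (actRight A) := by
  have h := ((graded_one fun a : Fin N => (a : ℕ)).kronecker hA).submatrix
    (Equiv.prodAssoc (Fin N) (Fin N) (Fin N))
  intro x y hxy
  simpa only [grade₃, grade₂, add_assoc, Function.comp_apply, Equiv.prodAssoc_apply] using
    h x y hxy

theorem weight_add_weight_eq {x y : Fin N × Fin N} (h : grade₂ N x = grade₂ N y) :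
    weight N x.1 + weight N x.2 = weight N y.1 + weight N y.2 := by
  have hcast : ((x.1 : ℕ) : ℂ) + (x.2 : ℕ) = (y.1 : ℕ) + (y.2 : ℕ) := by exact_mod_cast h
  simp only [weight]
  linear_combination hcast

theorem Graded.commute_cartan_kronecker_cartan (ht : t ≠ 0) (hA : Graded (grade₂ N) A) :
    Commute A (cartan N t ⊗ₖ cartan N t) := by
  rw [cartan, Matrix.diagonal_kronecker_diagonal]
  refine hA.commute_diagonal fun x y hxy => ?_
  rw [← Complex.cpow_add _ _ ht, ← Complex.cpow_add _ _ ht, ← add_div, ← add_div,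
    weight_add_weight_eq hxy]

theorem Graded.commute_cartanInv_kronecker_cartanInv (ht : t ≠ 0) (hA : Graded (grade₂ N) A) :
    Commute A (cartanInv N t ⊗ₖ cartanInv N t) := by
  rw [cartanInv, Matrix.diagonal_kronecker_diagonal]
  refine hA.commute_diagonal fun x y hxy => ?_
  rw [← Complex.cpow_add _ _ ht, ← Complex.cpow_add _ _ ht, ← add_div, ← add_div, ← neg_add,
    ← neg_add, weight_add_weight_eq hxy]

theorem commute_actLeft_raiseCoprod₃ (ht : t ≠ 0) (hA : Graded (grade₂ N) A)
    (h : Commute A (raiseCoprod N t)) : Commute (actLeft A) (raiseCoprod₃ N t) := by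
  have hK := hA.commute_cartanInv_kronecker_cartanInv ht
  rw [commute_iff_eq, actLeft, raiseCoprod₃, mul_add, add_mul]
  simp only [← Matrix.mul_kronecker_mul, h.eq, hK.eq, Matrix.one_mul, Matrix.mul_one]

theorem raiseCoprod₃_eq_submatrix (N : ℕ) (t : ℂ) : raiseCoprod₃ N t =
    (raiseMatrix N t ⊗ₖ (cartan N t ⊗ₖ cartan N t) + cartanInv N t ⊗ₖ raiseCoprod N t).submatrix
      (Equiv.prodAssoc _ _ _) (Equiv.prodAssoc _ _ _) := by
  ext ⟨⟨a, b⟩, c⟩ ⟨⟨a', b'⟩, c'⟩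
  simp only [raiseCoprod₃, raiseCoprod, Matrix.add_apply, Matrix.kroneckerMap_apply,
    Matrix.submatrix_apply, Equiv.prodAssoc_apply]
  ring

theorem commute_actRight_raiseCoprod₃ (ht : t ≠ 0) (hA : Graded (grade₂ N) A)
    (h : Commute A (raiseCoprod N t)) : Commute (actRight A) (raiseCoprod₃ N t) := by
  have hK := hA.commute_cartan_kronecker_cartan ht
  rw [commute_iff_eq, actRight, raiseCoprod₃_eq_submatrix, Matrix.submatrix_mul_equiv,
    Matrix.submatrix_mul_equiv, mul_add, add_mul]
  simp only [← Matrix.mul_kronecker_mul, h.eq, hK.eq, Matrix.one_mul, Matrix.mul_one]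

end TensorCube

/-- The partial quantum trace over the last tensor factor, in which the `c`-th diagonal entry is
weighted by `t^{wt(c)}`. -/
def quantumTrace {m : Type*} {N : ℕ} (t : ℂ) (B : Matrix (m × Fin N) (m × Fin N) ℂ) :
    Matrix m m ℂ :=
  partialTrace (fun c : Fin N => t ^ weight N c) B

theorem commute_quantumTrace {m : Type*} [Fintype m] [DecidableEq m] {N : ℕ} {t : ℂ} (ht : t ≠ 0)
    {w : m → ℕ} {wt : m → ℂ} (hwt : ∀ a b : m, wt a - wt b = w a - w b)
    {B : Matrix (m × Fin N) (m × Fin N) ℂ} {E : Matrix m m ℂ}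
    (hgraded : Graded (fun x => w x.1 + (x.2 : ℕ)) B)
    (hB : Commute B (E ⊗ₖ cartan N t + Matrix.diagonal (fun a => t ^ (-wt a / 2)) ⊗ₖ
      raiseMatrix N t)) :
    Commute (quantumTrace t B) E := by
  have hsq : quantumTrace t B =
      partialTrace (fun c : Fin N => t ^ (weight N c / 2) * t ^ (weight N c / 2)) B := by
    simp only [quantumTrace, ← Complex.cpow_add _ _ ht, add_halves]
  rw [hsq]
  refine commute_partialTrace hB fun a b c c' _ hne => ?_
  have hdeg : (w a : ℂ) + (c : ℕ) = w b + (c' : ℕ) := by exact_mod_cast hgraded _ _ hne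
  rw [← Complex.cpow_add _ _ ht, ← Complex.cpow_add _ _ ht]
  congr 1
  simp only [weight]
  linear_combination (hwt a b + hdeg) / 2

theorem commute_quantumTrace_quantumTrace_raiseMatrix {N : ℕ} {t : ℂ} (ht : t ≠ 0)
    {B : Matrix ((Fin N × Fin N) × Fin N) ((Fin N × Fin N) × Fin N) ℂ}
    (hgraded : Graded (grade₃ N) B) (hB : Commute B (raiseCoprod₃ N t)) :
    Commute (quantumTrace t (quantumTrace t B)) (raiseMatrix N t) := by
  have hfirst : Commute (quantumTrace t B) (raiseCoprod N t) := by
    refine commute_quantumTrace ht (w := grade₂ N)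
      (wt := fun a => weight N a.1 + weight N a.2) (fun a b => ?_) hgraded ?_
    · simp only [weight, grade₂]
      push_cast
      ring
    · rw [raiseCoprod₃, cartanInv, Matrix.diagonal_kronecker_diagonal] at hB
      simpa only [← Complex.cpow_add _ _ ht, ← add_div, ← neg_add] using hB
  refine commute_quantumTrace ht (w := fun a : Fin N => (a : ℕ))
    (wt := fun a => weight N a) (fun a b => ?_)
    (Graded.partialTrace (w := grade₂ N) (v := fun c : Fin N => (c : ℕ)) hgraded _) hfirst
  simp only [weight]
  ring

theorem Generic.apply_eq_apply_zero_of_commute_raiseMatrix {N : ℕ} {t : ℂ} (ht : Generic t)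
    {X : Matrix (Fin N) (Fin N) ℂ} (h : Commute X (raiseMatrix N t)) {a : ℕ} (ha : a < N) :
    X ⟨a, ha⟩ ⟨a, ha⟩ = X ⟨0, a.zero_le.trans_lt ha⟩ ⟨0, a.zero_le.trans_lt ha⟩ := by
  induction a with
  | zero => rfl
  | succ a ih =>
    have haN : a < N := a.lt_succ_self.trans ha
    have hentry := congrFun (congrFun h.eq ⟨a, haN⟩) ⟨a + 1, ha⟩
    rw [mul_raiseMatrix_apply_succ, raiseMatrix_mul_apply, dif_pos ha, mul_comm] at hentry
    rw [← ih haN, mul_left_cancel₀ (ht.brace_succ_ne_zero a) hentry]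

/-- The identification of colorings of three strands with triples. -/
def tripleEquiv (N : ℕ) : (Fin N × Fin N) × Fin N ≃ (Fin (2 + 1) → Fin N) where
  toFun x := ![x.1.1, x.1.2, x.2]
  invFun f := ((f 0, f 1), f 2)
  left_inv _ := rfl
  right_inv f := by
    ext i
    fin_cases i <;> rfl

theorem tripleEquiv_apply {N : ℕ} (x : (Fin N × Fin N) × Fin N) :
    tripleEquiv N x = ![x.1.1, x.1.2, x.2] := rfl

theorem actAt_zero_submatrix {N : ℕ} (A : Matrix (Fin N × Fin N) (Fin N × Fin N) ℂ) :
    (actAt A (0 : Fin 2)).submatrix (tripleEquiv N) (tripleEquiv N) = actLeft A := by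
  ext ⟨⟨a, b⟩, c⟩ ⟨⟨a', b'⟩, c'⟩
  simp only [Matrix.submatrix_apply, actAt, actLeft, Matrix.kroneckerMap_apply, Matrix.one_apply,
    mul_ite, mul_one, mul_zero]
  exact if_congr (by simp [Fin.forall_fin_succ, tripleEquiv_apply]) rfl rfl

theorem actAt_one_submatrix {N : ℕ} (A : Matrix (Fin N × Fin N) (Fin N × Fin N) ℂ) :
    (actAt A (1 : Fin 2)).submatrix (tripleEquiv N) (tripleEquiv N) = actRight A := by
  ext ⟨⟨a, b⟩, c⟩ ⟨⟨a', b'⟩, c'⟩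
  simp only [Matrix.submatrix_apply, actAt, actRight, Matrix.kroneckerMap_apply, Matrix.one_apply,
    ite_mul, one_mul, zero_mul]
  exact if_congr (by simp [Fin.forall_fin_succ, tripleEquiv_apply]) rfl rfl

/-- The matrix of the braid `σ₁ σ₂⁻¹ σ₁ σ₂⁻¹` on triples of basis vectors. -/
def figureEightMatrix (N : ℕ) (t : ℂ) :
    Matrix ((Fin N × Fin N) × Fin N) ((Fin N × Fin N) × Fin N) ℂ :=
  actLeft (rMatrix N t) * actRight (rMatrixInv N t) *
    (actLeft (rMatrix N t) * actRight (rMatrixInv N t))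

theorem braidMatrix_figureEight (N : ℕ) (t : ℂ) :
    (braidMatrix N t figureEight).submatrix (tripleEquiv N) (tripleEquiv N) =
      figureEightMatrix N t := by
  rw [figureEightMatrix, ← actAt_zero_submatrix, ← actAt_one_submatrix, Matrix.submatrix_mul_equiv,
    Matrix.submatrix_mul_equiv]
  simp [braidMatrix, figureEight, mul_assoc]

theorem longKnotMatrix_figureEight (N : ℕ) (t : ℂ) :
    longKnotMatrix N t figureEight = quantumTrace t (quantumTrace t (figureEightMatrix N t)) := by
  ext a b
  have hcons : ∀ a c d : Fin N, (Fin.cons a ((finTwoArrowEquiv (Fin N)).symm (c, d)) :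
      Fin 3 → Fin N) = tripleEquiv N ((a, c), d) := by
    intro a c d
    ext i
    fin_cases i <;> rfl
  have hwrithe : writhe figureEight = 0 := by decide
  simp only [longKnotMatrix, hwrithe, Int.cast_zero, neg_zero, zero_mul, zero_div,
    Complex.cpow_zero, one_mul, quantumTrace, partialTrace, ← braidMatrix_figureEight,
    Matrix.submatrix_apply, sum_mul]
  rw [← (finTwoArrowEquiv (Fin N)).symm.sum_comp, Fintype.sum_prod_type]
  refine sum_congr rfl fun c _ => sum_congr rfl fun d _ => ?_
  rw [hcons, hcons, Fin.prod_univ_two, mul_assoc, mul_comm (t ^ weight N d)]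
  rfl

theorem commute_longKnotMatrix_figureEight_raiseMatrix {t : ℂ} (ht : Generic t) (N : ℕ) :
    Commute (longKnotMatrix N t figureEight) (raiseMatrix N t) := by
  rw [longKnotMatrix_figureEight]
  have hgradedL := (graded_rMatrix N t).actLeft
  have hgradedR := (graded_rMatrixInv N t).actRight
  have hcommL := commute_actLeft_raiseCoprod₃ ht.ne_zero (graded_rMatrix N t)
    (commute_rMatrix_raiseCoprod ht N)
  have hcommR := commute_actRight_raiseCoprod₃ ht.ne_zero (graded_rMatrixInv N t)
    (commute_rMatrixInv_raiseCoprod ht N)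
  exact commute_quantumTrace_quantumTrace_raiseMatrix ht.ne_zero
    ((hgradedL.mul hgradedR).mul (hgradedL.mul hgradedR))
    ((hcommL.mul_left hcommR).mul_left (hcommL.mul_left hcommR))

theorem actLeft_mul_actRight_apply {N : ℕ} (A B : Matrix (Fin N × Fin N) (Fin N × Fin N) ℂ)
    (a b c a' b' c' : Fin N) : (actLeft A * actRight B) ((a, b), c) ((a', b'), c') =
      ∑ u, A (a, b) (a', u) * B (u, c) (b', c') := by
  simp [Matrix.mul_apply, Fintype.sum_prod_type, actLeft, actRight, Matrix.one_apply]

theorem rMatrix_last_apply (n : ℕ) (t : ℂ) (b k l : Fin (n + 1)) :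
    rMatrix (n + 1) t (Fin.last n, b) (k, l) =
      if l = Fin.last n ∧ k = b then t ^ (weight (n + 1) n * weight (n + 1) b) else 0 := by
  split_ifs with h
  · rw [h.1, h.2, rMatrix_apply]
    exact rEntry_self (n + 1) t n b
  · refine of_not_not fun hne => h ?_
    obtain ⟨hdeg, hle⟩ := rMatrix_ne_zero hne
    simp only [Fin.val_last, Fin.ext_iff] at hdeg hle ⊢
    omega

theorem rMatrix_apply_last (n : ℕ) (t : ℂ) (i j l : Fin (n + 1)) :
    rMatrix (n + 1) t (i, j) (Fin.last n, l) =
      if j = Fin.last n ∧ l = i then t ^ (weight (n + 1) n * weight (n + 1) i) else 0 := by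
  split_ifs with h
  · rw [h.1, h.2, rMatrix_apply, mul_comm]
    exact rEntry_self (n + 1) t i n
  · refine of_not_not fun hne => h ?_
    obtain ⟨hdeg, hle⟩ := rMatrix_ne_zero hne
    simp only [Fin.val_last, Fin.ext_iff] at hdeg hle ⊢
    omega

theorem rMatrixInv_apply_eq_zero_of_ne {N : ℕ} {t : ℂ} {a b c : Fin N} (h : b ≠ c) :
    rMatrixInv N t (a, b) (a, c) = 0 :=
  of_not_not fun hne => h (Fin.ext (Nat.add_left_cancel (rMatrixInv_ne_zero hne).1))

theorem figureEightMatrix_last (n : ℕ) (t : ℂ) (c d : Fin (n + 1)) :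
    figureEightMatrix (n + 1) t ((Fin.last n, c), d) ((Fin.last n, c), d) =
      t ^ (weight (n + 1) n * weight (n + 1) c) * t ^ (weight (n + 1) n * weight (n + 1) c) *
        (rMatrixInv (n + 1) t (Fin.last n, d) (Fin.last n, d) *
          rMatrixInv (n + 1) t (c, d) (c, d)) := by
  rw [figureEightMatrix, Matrix.mul_apply]
  simp only [Fintype.sum_prod_type, actLeft_mul_actRight_apply, rMatrix_last_apply,
    rMatrix_apply_last, ite_and, ite_mul, zero_mul, sum_ite_eq', sum_ite_irrel, sum_const_zero,
    mem_univ, if_true, mul_ite, mul_zero]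
  rw [sum_eq_single d (fun z _ hz => ?_) (by simp)]
  · ring
  · rw [rMatrixInv_apply_eq_zero_of_ne hz.symm, mul_zero, zero_mul]

theorem Generic.rMatrixInv_apply {t : ℂ} (ht : Generic t) (N : ℕ) (x y : Fin N × Fin N) :
    rMatrixInv N t x y = rEntry N t⁻¹ x.2 x.1 y.2 y.1 := by
  rw [ht.rMatrixInv_eq_submatrix_swap]
  rfl

theorem Generic.rEntry_inv_add {t : ℂ} (ht : Generic t) (N d m : ℕ) :
    rEntry N t⁻¹ d (d + m) d (d + m) = (-1) ^ m * qbinom t (d + m) m *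
      braceRising t (N - 1 - (d + m)) m * t ^ (-rExponent N d (d + m) m) := by
  rw [rEntry_add, ht.qbinom_inv, braceRising_inv ht.mem_slitPlane,
    inv_cpow_eq_cpow_neg ht.mem_slitPlane]
  ring

/-- The contribution to the state sum of the figure-eight knot of the state in which the cut strand
is colored by `n = c + i + j` and the closed strands are colored by `c + j` and `c`. -/
def stateTerm (t : ℂ) (c i j : ℕ) : ℂ :=
  (-1) ^ i * (braceFactorial t (c + i + j) / braceFactorial t c) *
    (braceFactorial t (i + j) / (braceFactorial t i * braceFactorial t j)) * braceRising t c j *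
    t ^ ((c + i + j : ℂ) - (c + i + j) * i / 2 + (c + i + j) * (i + j) - i * (i + j) / 2 -
      (i + j) ^ 2 / 2 - i ^ 2 / 4 - (i + j) / 2 - 5 * i / 4)

theorem Generic.mul_rEntry_inv_eq_stateTerm {t : ℂ} (ht : Generic t) {n c i j : ℕ}
    (hn : c + i + j = n) :
    t ^ (weight (n + 1) n * weight (n + 1) (c + j : ℕ)) *
        t ^ (weight (n + 1) n * weight (n + 1) (c + j : ℕ)) *
      (rEntry (n + 1) t⁻¹ c n c n * rEntry (n + 1) t⁻¹ c (c + j) c (c + j)) *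
      t ^ weight (n + 1) c * t ^ weight (n + 1) (c + j : ℕ) = stateTerm t c i j := by
  have hn' : n = c + (i + j) := by omega
  have hfirst : rEntry (n + 1) t⁻¹ c n c n = (-1) ^ (i + j) * qbinom t (c + (i + j)) (i + j) *
      braceRising t 0 (i + j) * t ^ (-rExponent (n + 1) c (c + (i + j)) (i + j)) := by
    have h := ht.rEntry_inv_add (n + 1) c (i + j)
    rw [show n + 1 - 1 - (c + (i + j)) = 0 by omega] at h
    exact (congrArg (fun m => rEntry (n + 1) t⁻¹ c m c m) hn').trans h
  have hsecond := ht.rEntry_inv_add (n + 1) c j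
  rw [show n + 1 - 1 - (c + j) = i by omega] at hsecond
  have hsign : (-1 : ℂ) ^ i = (-1) ^ (i + j) * (-1) ^ j := by
    rw [pow_add, mul_assoc, ← mul_pow, neg_one_mul, neg_neg, one_pow, mul_one]
  have hexp : (c + i + j : ℂ) - (c + i + j) * i / 2 + (c + i + j) * (i + j) - i * (i + j) / 2 -
      (i + j) ^ 2 / 2 - i ^ 2 / 4 - (i + j) / 2 - 5 * i / 4 =
      weight (n + 1) n * weight (n + 1) (c + j : ℕ) +
        weight (n + 1) n * weight (n + 1) (c + j : ℕ) +
        -rExponent (n + 1) c (c + (i + j)) (i + j) + -rExponent (n + 1) c (c + j) j +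
        weight (n + 1) c + weight (n + 1) (c + j : ℕ) := by
    simp only [weight, rExponent, hn']
    push_cast
    ring
  rw [hfirst, hsecond, stateTerm, hexp, hsign, ht.qbinom_add_right, ht.qbinom_add_right,
    ht.braceRising_eq_div 0, ht.braceRising_eq_div i, ht.braceRising_eq_div c, braceFactorial_zero,
    zero_add, ← add_assoc c i j]
  simp only [Complex.cpow_add _ _ ht.ne_zero]
  have hfac := ht.braceFactorial_ne_zero
  have hc := hfac c
  have hi := hfac i
  have hj := hfac j
  have hij := hfac (i + j)
  field_simp

theorem sum_range_sum_range_eq_sum_antidiagonal {M : Type*} [AddCommMonoid M] {f : ℕ → ℕ → M}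
    (hf : ∀ a b, b < a → f a b = 0) (n : ℕ) :
    ∑ a ∈ range (n + 1), ∑ b ∈ range (n + 1), f a b =
      ∑ x ∈ antidiagonal n, ∑ y ∈ antidiagonal x.2, f x.1 (x.1 + y.2) := by
  rw [Nat.sum_antidiagonal_eq_sum_range_succ_mk]
  refine sum_congr rfl fun a ha => ?_
  obtain ⟨p, rfl⟩ := Nat.exists_eq_add_of_le (Nat.lt_succ_iff.mp (mem_range.mp ha))
  rw [← Nat.sum_antidiagonal_swap, Nat.sum_antidiagonal_eq_sum_range_succ_mk, add_assoc,
    sum_range_add, sum_eq_zero fun b hb => hf a b (mem_range.mp hb), zero_add]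
  simp

theorem sum_antidiagonal_sum_antidiagonal_comm {M : Type*} [AddCommMonoid M] (n : ℕ)
    (f : ℕ → ℕ → ℕ → M) :
    ∑ x ∈ antidiagonal n, ∑ y ∈ antidiagonal x.2, f x.1 y.1 y.2 =
      ∑ x ∈ antidiagonal n, ∑ y ∈ antidiagonal x.2, f y.1 x.1 y.2 := by
  rw [sum_sigma', sum_sigma']
  refine sum_nbij' (fun z => ⟨(z.2.1, z.1.1 + z.2.2), (z.1.1, z.2.2)⟩)
    (fun z => ⟨(z.2.1, z.1.1 + z.2.2), (z.1.1, z.2.2)⟩) ?_ ?_ ?_ ?_ fun _ _ => rfl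
  all_goals
    rintro ⟨⟨a, b⟩, c, d⟩ h
    simp only [mem_sigma, HasAntidiagonal.mem_antidiagonal, Sigma.mk.injEq, Prod.mk.injEq,
      heq_eq_eq, and_true, true_and] at h ⊢
    omega

theorem Generic.longKnotMatrix_figureEight_last {t : ℂ} (ht : Generic t) (n : ℕ) :
    longKnotMatrix (n + 1) t figureEight (Fin.last n) (Fin.last n) =
      ∑ x ∈ antidiagonal n, ∑ y ∈ antidiagonal x.2, stateTerm t x.1 y.1 y.2 := by
  let f (c b : ℕ) : ℂ := t ^ (weight (n + 1) n * weight (n + 1) b) *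
    t ^ (weight (n + 1) n * weight (n + 1) b) *
      (rEntry (n + 1) t⁻¹ c n c n * rEntry (n + 1) t⁻¹ c b c b) *
      t ^ weight (n + 1) c * t ^ weight (n + 1) b
  have hf : ∀ c b, b < c → f c b = 0 := fun c b hbc => by
    simp only [f, rEntry_of_not (i := c) (l := b) fun h => h.2.not_gt hbc, mul_zero, zero_mul]
  have hsum : longKnotMatrix (n + 1) t figureEight (Fin.last n) (Fin.last n) =
      ∑ c ∈ range (n + 1), ∑ b ∈ range (n + 1), f c b := by
    simp only [longKnotMatrix_figureEight, quantumTrace, partialTrace, figureEightMatrix_last,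
      ht.rMatrixInv_apply, sum_mul, Fin.val_last, sum_range]
    exact sum_comm
  rw [hsum, sum_range_sum_range_eq_sum_antidiagonal hf]
  refine sum_congr rfl fun x hx => sum_congr rfl fun y hy => ?_
  rw [HasAntidiagonal.mem_antidiagonal] at hx hy
  exact ht.mul_rEntry_inv_eq_stateTerm (by omega)

theorem Generic.braceRising_eq_sum_antidiagonal {t : ℂ} (ht : Generic t) (c j : ℕ) :
    braceRising t c j = ∑ x ∈ antidiagonal j, (-1) ^ x.1 *
      (braceFactorial t j / (braceFactorial t x.1 * braceFactorial t x.2)) *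
        t ^ (((x.2 : ℂ) - x.1) * (2 * c + j + 1) / 4) := by
  rw [braceRising_eq_sum_qbinom ht.ne_zero, ← Nat.sum_antidiagonal_swap,
    Nat.sum_antidiagonal_eq_sum_range_succ_mk]
  refine sum_congr rfl fun k hk => ?_
  obtain ⟨a, rfl⟩ := Nat.exists_eq_add_of_le' (Nat.lt_succ_iff.mp (mem_range.mp hk))
  simp only [Prod.swap, Nat.add_sub_cancel]
  rw [ht.qbinom_add_right]
  push_cast
  ring_nf

/-- The summand that arises from `stateTerm t c i (a + b)` by expanding its rising product. -/
def expandedTerm (t : ℂ) (c i a b : ℕ) : ℂ :=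
  (-1) ^ (i + a) * (braceFactorial t (c + i + (a + b)) / braceFactorial t c) *
    (braceFactorial t (i + (a + b)) /
      (braceFactorial t i * braceFactorial t a * braceFactorial t b)) *
    t ^ ((c + i + (a + b) : ℂ) - (c + i + (a + b)) * i / 2 + (c + i + (a + b)) * (i + (a + b)) -
      i * (i + (a + b)) / 2 - (i + (a + b)) ^ 2 / 2 - i ^ 2 / 4 - (i + (a + b)) / 2 - 5 * i / 4 +
      (b - a) * (2 * c + (a + b) + 1) / 4)

/-- The sum of the terms `expandedTerm t c i a b` over `i + b = k`. -/
def collectedTerm (t : ℂ) (c k a : ℕ) : ℂ :=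
  (-1) ^ a * (braceFactorial t (c + a + k) / braceFactorial t c) *
    (braceFactorial t (k + a) / (braceFactorial t k * braceFactorial t a)) *
    braceRising t (c + a + k + 1) k *
    t ^ ((c + a : ℂ) * (k + 1) + (c + a) * a / 2 - k * a / 2 - a ^ 2 / 4 - 3 * a / 4)

/-- The `k`-th summand of Habiro's cyclotomic expansion of the `N`-colored Jones polynomial of the
figure-eight knot. -/
def cyclotomicTerm (t : ℂ) (N k : ℕ) : ℂ :=
  ∏ s ∈ range k, brace t (N + (s + 1)) * brace t (N - (s + 1))

namespace Generic

variable {t : ℂ} (ht : Generic t)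
include ht

theorem stateTerm_eq_sum_expandedTerm (c i j : ℕ) :
    stateTerm t c i j = ∑ x ∈ antidiagonal j, expandedTerm t c i x.1 x.2 := by
  rw [stateTerm, ht.braceRising_eq_sum_antidiagonal, mul_sum, sum_mul]
  refine sum_congr rfl fun x hx => ?_
  obtain rfl : x.1 + x.2 = j := HasAntidiagonal.mem_antidiagonal.mp hx
  have hj := ht.braceFactorial_ne_zero (x.1 + x.2)
  rw [expandedTerm, pow_add, Complex.cpow_add (_ - _) _ ht.ne_zero]
  push_cast
  field_simp

theorem sum_expandedTerm (c k a : ℕ) :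
    ∑ x ∈ antidiagonal k, expandedTerm t c x.1 a x.2 = collectedTerm t c k a := by
  rw [collectedTerm, ht.braceRising_eq_sum_antidiagonal, mul_sum, sum_mul]
  refine sum_congr rfl fun x hx => ?_
  obtain ⟨i, b⟩ := x
  obtain rfl : i + b = k := HasAntidiagonal.mem_antidiagonal.mp hx
  have hk := ht.braceFactorial_ne_zero (i + b)
  have hexp : (c + i + (a + b) : ℂ) - (c + i + (a + b)) * i / 2 +
      (c + i + (a + b)) * (i + (a + b)) - i * (i + (a + b)) / 2 - (i + (a + b)) ^ 2 / 2 -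
      i ^ 2 / 4 - (i + (a + b)) / 2 - 5 * i / 4 + (b - a) * (2 * c + (a + b) + 1) / 4 =
      (c + a : ℂ) * ((i + b : ℕ) + 1) + (c + a) * a / 2 - (i + b : ℕ) * a / 2 - a ^ 2 / 4 -
        3 * a / 4 +
      ((b : ℂ) - i) * (2 * (c + a + (i + b) + 1 : ℕ) + (i + b : ℕ) + 1) / 4 := by
    push_cast
    ring
  rw [expandedTerm, hexp, pow_add, Complex.cpow_add _ _ ht.ne_zero,
    show i + (a + b) = i + b + a by ring, show c + i + (a + b) = c + a + (i + b) by ring]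
  field_simp

theorem cyclotomicTerm_eq (k m : ℕ) : cyclotomicTerm t (m + k + 1) k =
    braceFactorial t (m + k) / braceFactorial t m * braceRising t (m + k + 1) k := by
  rw [cyclotomicTerm, prod_mul_distrib, mul_comm, ← ht.braceRising_eq_div]
  congr 1
  rw [braceRising, ← prod_range_reflect]
  refine prod_congr rfl fun s hs => congrArg _ ?_
  have := mem_range.mp hs
  omega

theorem sum_collectedTerm (k m : ℕ) :
    ∑ x ∈ antidiagonal m, collectedTerm t x.1 k x.2 = cyclotomicTerm t (m + k + 1) k := by
  rw [ht.cyclotomicTerm_eq, ← mul_one (_ / _ * _), ← ht.sum_qbinom_mul_braceRising m k, mul_sum,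
    ← Nat.sum_antidiagonal_swap, Nat.sum_antidiagonal_eq_sum_range_succ_mk]
  refine sum_congr rfl fun a ha => ?_
  obtain ⟨c, rfl⟩ := Nat.exists_eq_add_of_le' (Nat.lt_succ_iff.mp (mem_range.mp ha))
  have hm := ht.braceFactorial_ne_zero (c + a)
  simp only [Prod.swap, Nat.add_sub_cancel]
  rw [collectedTerm, ht.qbinom_add_right, ht.braceRising_eq_div k a]
  push_cast
  field_simp

theorem longKnotMatrix_figureEight_last_eq_sum_cyclotomicTerm (n : ℕ) :
    longKnotMatrix (n + 1) t figureEight (Fin.last n) (Fin.last n) =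
      ∑ k ∈ range (n + 1), cyclotomicTerm t (n + 1) k := by
  calc longKnotMatrix (n + 1) t figureEight (Fin.last n) (Fin.last n)
      = ∑ x ∈ antidiagonal n, ∑ y ∈ antidiagonal x.2, ∑ z ∈ antidiagonal y.2,
          expandedTerm t x.1 y.1 z.1 z.2 := by
        simp only [ht.longKnotMatrix_figureEight_last, ht.stateTerm_eq_sum_expandedTerm]
    _ = ∑ x ∈ antidiagonal n, ∑ y ∈ antidiagonal x.2, collectedTerm t x.1 y.1 y.2 := by
        refine sum_congr rfl fun x _ => ?_
        rw [sum_antidiagonal_sum_antidiagonal_comm x.2 (expandedTerm t x.1),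
          ← Nat.sum_antidiagonal_swap]
        exact sum_congr rfl fun y _ => ht.sum_expandedTerm x.1 y.1 y.2
    _ = ∑ x ∈ antidiagonal n, cyclotomicTerm t (x.2 + x.1 + 1) x.1 := by
        rw [sum_antidiagonal_sum_antidiagonal_comm n (collectedTerm t)]
        simp only [ht.sum_collectedTerm]
    _ = ∑ k ∈ range (n + 1), cyclotomicTerm t (n + 1) k := by
        rw [Nat.sum_antidiagonal_eq_sum_range_succ_mk]
        refine sum_congr rfl fun k hk => ?_
        rw [Nat.sub_add_cancel (Nat.lt_succ_iff.mp (mem_range.mp hk))]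

theorem coloredJones_figureEight (N : ℕ) :
    coloredJones N figureEight t = ∑ k ∈ range N, cyclotomicTerm t N k := by
  rcases N with _ | n
  · simp [coloredJones]
  · rw [coloredJones, dif_pos n.succ_pos, ← ht.apply_eq_apply_zero_of_commute_raiseMatrix
      (commute_longKnotMatrix_figureEight_raiseMatrix ht (n + 1)) n.lt_succ_self]
    exact ht.longKnotMatrix_figureEight_last_eq_sum_cyclotomicTerm n

end Generic

section Continuity

theorem continuousOn_cpow_const (z : ℂ) : ContinuousOn (fun t : ℂ => t ^ z) Complex.slitPlane :=
  continuousOn_id.cpow continuousOn_const fun _ ht => ht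

theorem continuousOn_brace (m : ℕ) : ContinuousOn (fun t => brace t m) Complex.slitPlane :=
  (continuousOn_cpow_const _).sub (continuousOn_cpow_const _)

theorem continuousOn_braceRising (a m : ℕ) :
    ContinuousOn (fun t => braceRising t a m) Complex.slitPlane :=
  continuousOn_finsetProd _ fun _ _ => continuousOn_brace _

theorem continuousOn_qbinom (n k : ℕ) :
    ContinuousOn (fun t => qbinom t n k) Complex.slitPlane := by
  induction n generalizing k with
  | zero => cases k <;> exact continuousOn_const
  | succ n ih => cases k with
    | zero => exact continuousOn_const
    | succ k =>
      simp only [qbinom_succ_succ]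
      exact ((continuousOn_cpow_const _).mul (ih _)).add ((continuousOn_cpow_const _).mul (ih _))

theorem continuousOn_rMatrix (N : ℕ) (x y : Fin N × Fin N) :
    ContinuousOn (fun t => rMatrix N t x y) Complex.slitPlane := by
  simp only [rMatrix]
  split_ifs
  · exact ((continuousOn_qbinom _ _).mul (continuousOn_braceRising _ _)).mul
      (continuousOn_cpow_const _)
  · exact continuousOn_const

theorem continuousOn_rMatrixInv (N : ℕ) (x y : Fin N × Fin N) :
    ContinuousOn (fun t => rMatrixInv N t x y) Complex.slitPlane := by
  simp only [rMatrixInv]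
  split_ifs
  · exact ((continuousOn_const.mul (continuousOn_qbinom _ _)).mul
      (continuousOn_braceRising _ _)).mul (continuousOn_cpow_const _)
  · exact continuousOn_const

variable {n : ℕ} (N : ℕ)

theorem continuousOn_braidMatrix (β : BraidWord n) (x y : Fin (n + 1) → Fin N) :
    ContinuousOn (fun t => braidMatrix N t β x y) Complex.slitPlane := by
  induction β generalizing x with
  | nil => exact continuousOn_const
  | cons g β ih =>
    simp only [braidMatrix, List.map_cons, List.prod_cons, Matrix.mul_apply, actAt]
    refine continuousOn_finsetSum _ fun z _ => ContinuousOn.mul ?_ (ih z)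
    split_ifs
    · exact continuousOn_rMatrix N _ _
    · exact continuousOn_rMatrixInv N _ _
    · exact continuousOn_const

theorem continuousOn_coloredJones (β : BraidWord n) :
    ContinuousOn (coloredJones N β) Complex.slitPlane := by
  unfold coloredJones
  split_ifs
  · exact (continuousOn_cpow_const _).mul (continuousOn_finsetSum _ fun _ _ =>
      (continuousOn_braidMatrix N β _ _).mul (continuousOn_finsetProd _ fun _ _ =>
        continuousOn_cpow_const _))
  · exact continuousOn_const

end Continuity

theorem generic_of_pow_succ_ne_one {t : ℂ} (ht : t ∈ Complex.slitPlane)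
    (hpow : ∀ k : ℕ, t ^ (k + 1) ≠ 1) : Generic t where
  mem_slitPlane := ht
  brace_succ_ne_zero k hk := hpow k <| by
    have h0 := Complex.slitPlane_ne_zero ht
    calc t ^ (k + 1) = t ^ (((k + 1 : ℕ) : ℂ) / 2 + ((k + 1 : ℕ) : ℂ) / 2) := by
          rw [add_halves, Complex.cpow_natCast]
      _ = t ^ (-((k + 1 : ℕ) : ℂ) / 2 + ((k + 1 : ℕ) : ℂ) / 2) := by
          rw [Complex.cpow_add _ _ h0, Complex.cpow_add _ _ h0, sub_eq_zero.mp hk]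
      _ = 1 := by rw [neg_div, neg_add_cancel, Complex.cpow_zero]

theorem dense_forall_pow_succ_ne_one : Dense {t : ℂ | ∀ k : ℕ, t ^ (k + 1) ≠ 1} := by
  have hcountable : (⋃ k : ℕ, {t : ℂ | t ^ (k + 1) = 1}).Countable :=
    Set.countable_iUnion fun k =>
      (Polynomial.nthRoots (k + 1) (1 : ℂ)).toFinset.countable_toSet.mono fun t ht => by
        simpa [Polynomial.mem_nthRoots k.succ_pos] using ht
  exact (hcountable.dense_compl ℝ).mono fun t (ht : t ∉ _) k hk => ht (Set.mem_iUnion.mpr ⟨k, hk⟩)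

theorem coloredJones_figureEight_eq_sum {t : ℂ} (ht : t ∈ Complex.slitPlane) (N : ℕ) :
    coloredJones N figureEight t = ∑ k ∈ range N, cyclotomicTerm t N k := by
  have hcont : ContinuousOn (fun t => ∑ k ∈ range N, cyclotomicTerm t N k) Complex.slitPlane :=
    continuousOn_finsetSum _ fun _ _ => continuousOn_finsetProd _ fun _ _ =>
      (continuousOn_brace _).mul (continuousOn_brace _)
  have hgeneric : Set.EqOn (coloredJones N figureEight)
      (fun t => ∑ k ∈ range N, cyclotomicTerm t N k)
      (Complex.slitPlane ∩ {t | ∀ k : ℕ, t ^ (k + 1) ≠ 1}) := fun z hz =>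
    (generic_of_pow_succ_ne_one hz.1 hz.2).coloredJones_figureEight N
  exact hgeneric.of_subset_closure (continuousOn_coloredJones N figureEight) hcont
    Set.inter_subset_left
    (dense_forall_pow_succ_ne_one.open_subset_closure_inter Complex.isOpen_slitPlane) ht

/-- The factor `{N + k} {N - k}` at `t = exp(2 π r √-1 / N)`. -/
def habiroFactor (r : ℝ) (N k : ℕ) : ℝ :=
  4 * (Real.sin (Real.pi * r * (k / N)) ^ 2 - Real.sin (Real.pi * r) ^ 2)

/-- The `m`-th summand of the cyclotomic expansion at `t = exp(2 π r √-1 / N)`. -/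
def habiroProd (r : ℝ) (N m : ℕ) : ℝ := ∏ s ∈ range m, habiroFactor r N (s + 1)

/-- The value of the `N`-colored Jones polynomial of the figure-eight knot at
`t = exp(2 π r √-1 / N)`, as given by its cyclotomic expansion. -/
def habiroSum (r : ℝ) (N : ℕ) : ℝ := ∑ m ∈ range N, habiroProd r N m

theorem cpow_natCast_add_cpow_neg_natCast_exp (θ : ℝ) (m : ℕ) :
    Complex.exp (θ * Complex.I) ^ (m : ℂ) + Complex.exp (θ * Complex.I) ^ (-(m : ℂ)) =
      2 - 4 * (Real.sin (θ * m / 2) ^ 2 : ℝ) := by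
  have hcos : Real.cos (θ * m) = 1 - 2 * Real.sin (θ * m / 2) ^ 2 := by
    rw [← Real.cos_two_mul_eq_one_sub]
    ring_nf
  have hmul : (m : ℂ) * (θ * Complex.I) = (θ * m : ℝ) * Complex.I := by
    push_cast
    ring
  rw [Complex.cpow_neg, Complex.cpow_natCast, ← Complex.exp_nat_mul, ← Complex.exp_neg, hmul,
    ← neg_mul, ← Complex.two_cos, ← Complex.ofReal_cos, hcos]
  push_cast
  ring

theorem brace_mul_brace_exp {r : ℝ} {N k : ℕ} (hN : N ≠ 0) (hk : k ≤ N) :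
    brace (Complex.exp ((2 * Real.pi * r / N : ℝ) * Complex.I)) (N + k) *
      brace (Complex.exp ((2 * Real.pi * r / N : ℝ) * Complex.I)) (N - k) =
        habiroFactor r N k := by
  have hN' : (N : ℝ) ≠ 0 := Nat.cast_ne_zero.mpr hN
  rw [brace_add_mul_brace_sub (Complex.exp_ne_zero _) hk, cpow_natCast_add_cpow_neg_natCast_exp,
    cpow_natCast_add_cpow_neg_natCast_exp, habiroFactor,
    show 2 * Real.pi * r / N * N / 2 = Real.pi * r by field_simp,
    show 2 * Real.pi * r / N * k / 2 = Real.pi * r * (k / N) by field_simp]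
  push_cast
  ring

theorem exp_mul_I_mem_slitPlane {θ : ℝ} (hθ : |θ| < Real.pi) :
    Complex.exp (θ * Complex.I) ∈ Complex.slitPlane := by
  obtain ⟨hlower, hupper⟩ := abs_lt.mp hθ
  rw [Complex.mem_slitPlane_iff_arg, Complex.arg_exp_mul_I,
    (toIocMod_eq_self _).mpr ⟨hlower, by linarith⟩]
  exact ⟨hupper.ne, Complex.exp_ne_zero _⟩

theorem coloredJones_figureEight_exp {r : ℝ} {N : ℕ} (hN : 2 * |r| < N) :
    coloredJones N figureEight (Complex.exp (2 * Real.pi * r * Complex.I / N)) = habiroSum r N := by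
  have hN0 : (0 : ℝ) < N := lt_of_le_of_lt (by positivity) hN
  have hθ : |2 * Real.pi * r / N| < Real.pi := by
    rw [abs_div, abs_mul, abs_of_pos hN0, div_lt_iff₀ hN0, abs_of_pos Real.two_pi_pos]
    nlinarith [Real.pi_pos]
  have harg : 2 * (Real.pi : ℂ) * r * Complex.I / N = (2 * Real.pi * r / N : ℝ) * Complex.I := by
    push_cast
    ring
  rw [harg, coloredJones_figureEight_eq_sum (exp_mul_I_mem_slitPlane hθ), habiroSum,
    Complex.ofReal_sum]
  refine sum_congr rfl fun m hm => ?_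
  rw [cyclotomicTerm, habiroProd, Complex.ofReal_prod]
  refine prod_congr rfl fun s hs => brace_mul_brace_exp (Nat.cast_pos.mp hN0).ne' ?_
  have := mem_range.mp hm
  have := mem_range.mp hs
  omega

theorem abs_sin_sq_sub_le (x y : ℝ) : |Real.sin x ^ 2 - Real.sin y ^ 2| ≤ 2 * |x - y| := by
  have hadd : |Real.sin x + Real.sin y| ≤ 2 :=
    (abs_add_le _ _).trans (by linarith [Real.abs_sin_le_one x, Real.abs_sin_le_one y])
  rw [sq_sub_sq, abs_mul]
  exact mul_le_mul hadd (Real.abs_sin_sub_sin_le x y) (abs_nonneg _) zero_le_two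

theorem two_mul_abs_le_abs_sin_pi_mul {x : ℝ} (hx : |x| ≤ 1 / 2) :
    2 * |x| ≤ |Real.sin (Real.pi * x)| := by
  have hpi := Real.pi_pos
  have habs : |Real.pi * x| = Real.pi * |x| := by rw [abs_mul, abs_of_pos hpi]
  have hjordan := Real.mul_abs_le_abs_sin (x := Real.pi * x) (by rw [habs]; nlinarith)
  rwa [habs, ← mul_assoc, div_mul_cancel₀ _ hpi.ne'] at hjordan

theorem mul_sin_le_sin_mul {c x : ℝ} (hc0 : 0 ≤ c) (hc1 : c ≤ 1) (hx0 : 0 ≤ x)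
    (hx : x ≤ Real.pi) : c * Real.sin x ≤ Real.sin (c * x) := by
  simpa using strictConcaveOn_sin_Icc.concaveOn.2 (x := 0) (y := x) ⟨le_rfl, Real.pi_pos.le⟩
    ⟨hx0, hx⟩ (sub_nonneg.mpr hc1) hc0 (sub_add_cancel 1 c)

theorem natCast_div_le_one {N k : ℕ} (hk : k ≤ N) : (k : ℝ) / N ≤ 1 :=
  div_le_one_of_le₀ (Nat.cast_le.mpr hk) (Nat.cast_nonneg N)

theorem abs_habiroFactor_sub_le (r : ℝ) {N k : ℕ} (hk : k ≤ N) :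
    |habiroFactor r N k - habiroFactor 1 N k| ≤ 64 * |r - 1| := by
  have hpi := Real.pi_lt_four
  have hsin : ∀ x : ℝ, 0 ≤ x → x ≤ 1 →
      |Real.sin (Real.pi * r * x) ^ 2 - Real.sin (Real.pi * 1 * x) ^ 2| ≤ 8 * |r - 1| := by
    intro x hx0 hx1
    refine (abs_sin_sq_sub_le _ _).trans ?_
    rw [show Real.pi * r * x - Real.pi * 1 * x = Real.pi * x * (r - 1) by ring, abs_mul,
      abs_of_nonneg (by positivity), ← mul_assoc]
    exact mul_le_mul_of_nonneg_right (by nlinarith) (abs_nonneg _)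
  have hk_term := hsin (k / N) (by positivity) (natCast_div_le_one hk)
  have h_one := hsin 1 zero_le_one le_rfl
  rw [mul_one, mul_one] at h_one
  rw [habiroFactor, habiroFactor, ← mul_sub, abs_mul, abs_of_pos (by norm_num : (0 : ℝ) < 4),
    sub_sub_sub_comm]
  linarith [abs_sub (Real.sin (Real.pi * r * (k / N)) ^ 2 - Real.sin (Real.pi * 1 * (k / N)) ^ 2)
    (Real.sin (Real.pi * r) ^ 2 - Real.sin (Real.pi * 1) ^ 2)]

theorem habiroFactor_one (N k : ℕ) : habiroFactor 1 N k = 4 * Real.sin (Real.pi * (k / N)) ^ 2 := by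
  simp [habiroFactor]

theorem habiroFactor_one_nonneg (N k : ℕ) : 0 ≤ habiroFactor 1 N k := by
  rw [habiroFactor_one]
  positivity

theorem habiroProd_one_nonneg (N m : ℕ) : 0 ≤ habiroProd 1 N m :=
  prod_nonneg fun _ _ => habiroFactor_one_nonneg _ _

theorem habiroFactor_one_le_of_edge {N k : ℕ} (hN : 0 < N) (hk : k ≤ N)
    (hedge : 12 * k ≤ N ∨ 11 * N ≤ 12 * k) : habiroFactor 1 N k ≤ 9 / 20 := by
  have hN' : (0 : ℝ) < N := Nat.cast_pos.mpr hN
  have hsmall : ∀ x : ℝ, 0 ≤ x → x ≤ 1 / 12 → 4 * Real.sin (Real.pi * x) ^ 2 ≤ 9 / 20 := by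
    intro x hx0 hx1
    have hpi := Real.pi_lt_four
    have hpi0 := Real.pi_pos
    have hsin_le : Real.sin (Real.pi * x) ≤ Real.pi * x := Real.sin_le (by positivity)
    have hsin_nonneg : 0 ≤ Real.sin (Real.pi * x) :=
      Real.sin_nonneg_of_nonneg_of_le_pi (by positivity) (by nlinarith)
    have hthird : Real.pi * x ≤ 1 / 3 := by nlinarith
    nlinarith
  rw [habiroFactor_one]
  rcases hedge with hleft | hright
  · refine hsmall _ (by positivity) ?_
    rw [div_le_div_iff₀ hN' (by norm_num)]
    have : (12 : ℝ) * k ≤ N := by exact_mod_cast hleft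
    linarith
  · have hright' : (11 : ℝ) * N ≤ 12 * k := by exact_mod_cast hright
    have hreflect := hsmall (1 - k / N) (sub_nonneg.mpr (natCast_div_le_one hk))
      (by rw [sub_le_iff_le_add, ← sub_le_iff_le_add', le_div_iff₀ hN']; linarith)
    rwa [mul_sub, mul_one, Real.sin_pi_sub] at hreflect

theorem abs_habiroFactor_le_half {r : ℝ} (hr : |r - 1| ≤ 1 / 1280) {N k : ℕ} (hN : 0 < N)
    (hk : k ≤ N) (hedge : 12 * k ≤ N ∨ 11 * N ≤ 12 * k) : |habiroFactor r N k| ≤ 1 / 2 := by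
  have hsub := abs_le.mp (abs_habiroFactor_sub_le r hk)
  have hle := habiroFactor_one_le_of_edge hN hk hedge
  have hnonneg := habiroFactor_one_nonneg N k
  exact abs_le.mpr ⟨by linarith [hsub.1], by linarith [hsub.2]⟩

theorem le_habiroFactor_one_of_bulk {η : ℝ} (hη : 0 ≤ η) {N k : ℕ} (hN : 0 < N)
    (hlower : η * N ≤ k) (hupper : (k : ℝ) ≤ (1 - η) * N) :
    16 * η ^ 2 ≤ habiroFactor 1 N k := by
  have hN' : (0 : ℝ) < N := Nat.cast_pos.mpr hN
  have hx0 : η ≤ (k : ℝ) / N := (le_div_iff₀ hN').mpr hlower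
  have hx1 : (k : ℝ) / N ≤ 1 - η := (div_le_iff₀ hN').mpr hupper
  have hsin : |2 * η| ≤ |Real.sin (Real.pi * (k / N))| := by
    rw [abs_of_nonneg (by positivity)]
    rcases le_total ((k : ℝ) / N) (1 / 2) with hhalf | hhalf
    · have habs : |(k : ℝ) / N| = k / N := abs_of_nonneg (hη.trans hx0)
      linarith [two_mul_abs_le_abs_sin_pi_mul (habs.trans_le hhalf)]
    · have habs : |1 - (k : ℝ) / N| = 1 - k / N := abs_of_nonneg (by linarith)
      have hreflect := two_mul_abs_le_abs_sin_pi_mul (x := 1 - k / N) (by linarith)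
      rw [mul_sub Real.pi, mul_one, Real.sin_pi_sub] at hreflect
      linarith
  rw [habiroFactor_one]
  linarith [sq_le_sq.mpr hsin]

theorem abs_habiroFactor_sub_le_mul {η κ r : ℝ} (hη : 0 ≤ η) (hκ : 4 * |r - 1| ≤ κ * η ^ 2)
    (hκ0 : 0 ≤ κ) {N k : ℕ} (hN : 0 < N) (hk : k ≤ N) (hlower : η * N ≤ k)
    (hupper : (k : ℝ) ≤ (1 - η) * N) :
    |habiroFactor r N k - habiroFactor 1 N k| ≤ κ * habiroFactor 1 N k :=
  calc |habiroFactor r N k - habiroFactor 1 N k| ≤ 64 * |r - 1| := abs_habiroFactor_sub_le r hk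
    _ ≤ κ * (16 * η ^ 2) := by linarith
    _ ≤ κ * habiroFactor 1 N k :=
      mul_le_mul_of_nonneg_left (le_habiroFactor_one_of_bulk hη hN hlower hupper) hκ0

theorem mul_factorial_div_two_pow_le_prod_add {γ x : ℝ} (hγ0 : 0 ≤ γ) (hγ1 : γ ≤ 1)
    (hx : γ ≤ x) (n : ℕ) :
    γ * (n.factorial / 2 ^ n) ≤ ∏ s ∈ range n, ((s : ℝ) + x) := by
  induction n with
  | zero => simpa using hγ1
  | succ n ih =>
    rw [prod_range_succ, Nat.factorial_succ, pow_succ]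
    rcases n with _ | n
    · norm_num
      linarith
    · have hpos : 0 ≤ γ * (((n + 1).factorial : ℝ) / 2 ^ (n + 1)) := by positivity
      calc γ * (((n + 1 + 1) * (n + 1).factorial : ℕ) / (2 ^ (n + 1) * 2) : ℝ)
          = γ * (((n + 1).factorial : ℝ) / 2 ^ (n + 1)) * (((n : ℝ) + 2) / 2) := by
            push_cast
            field_simp
            ring
        _ ≤ (∏ s ∈ range (n + 1), ((s : ℝ) + x)) * (((n + 1 : ℕ) : ℝ) + x) := by
            refine mul_le_mul ih ?_ (by positivity) (hpos.trans ih)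
            push_cast
            linarith [n.cast_nonneg (α := ℝ)]

theorem factorial_add_le_two_pow_mul (a b : ℕ) :
    (a + b).factorial ≤ 2 ^ (a + b) * (a.factorial * b.factorial) := by
  rw [← Nat.add_choose_mul_factorial_mul_factorial, mul_assoc]
  exact Nat.mul_le_mul_right _ (Nat.choose_le_two_pow _ _)

theorem prod_abs_succ_sub_natCast_add (b d : ℕ) {x : ℝ} (hx0 : 0 ≤ x) (hx1 : x ≤ 1) :
    ∏ s ∈ range (b + d), |((s + 1 : ℕ) : ℝ) - (b + x)| =
      (∏ s ∈ range b, ((s : ℝ) + x)) * ∏ s ∈ range d, ((s : ℝ) + (1 - x)) := by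
  rw [prod_range_add, ← prod_range_reflect (fun s : ℕ => |((s + 1 : ℕ) : ℝ) - (b + x)|)]
  congr 1
  · refine prod_congr rfl fun s hs => ?_
    rw [mem_range] at hs
    rw [show b - 1 - s + 1 = b - s by omega, Nat.cast_sub hs.le, abs_sub_comm, abs_of_nonneg]
    · ring
    · linarith [s.cast_nonneg (α := ℝ)]
  · refine prod_congr rfl fun s _ => ?_
    rw [abs_of_nonneg]
    · push_cast
      ring
    · push_cast
      linarith [s.cast_nonneg (α := ℝ)]

theorem sq_mul_factorial_div_four_pow_le_prod_abs_sub {γ β : ℝ} (hγ : 0 ≤ γ) (hβ : 0 ≤ β)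
    (hfract : Int.fract β ∈ Set.Icc γ (1 - γ)) {K : ℕ} (hK : β ≤ K) :
    γ ^ 2 * (K.factorial / 4 ^ K) ≤ ∏ s ∈ range K, |((s + 1 : ℕ) : ℝ) - β| := by
  obtain ⟨hlower, hupper⟩ := hfract
  set b := ⌊β⌋₊
  set x := Int.fract β with hx
  have hβx : β = b + x := by
    rw [hx, Int.fract, ← natCast_floor_eq_intCast_floor hβ]
    ring
  have hγ1 : γ ≤ 1 := by linarith
  obtain ⟨d, rfl⟩ : ∃ d, K = b + d := Nat.exists_eq_add_of_le (Nat.floor_le_of_le hK)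
  rw [hβx, prod_abs_succ_sub_natCast_add b d (hγ.trans hlower) (by linarith)]
  have hbelow := mul_factorial_div_two_pow_le_prod_add hγ hγ1 hlower b
  have habove := mul_factorial_div_two_pow_le_prod_add hγ hγ1 (le_sub_comm.mp hupper) d
  have hfactorial : ((b + d).factorial : ℝ) ≤ 2 ^ (b + d) * (b.factorial * d.factorial) := by
    exact_mod_cast factorial_add_le_two_pow_mul b d
  calc γ ^ 2 * ((b + d).factorial / 4 ^ (b + d))
      ≤ γ ^ 2 * (2 ^ (b + d) * (b.factorial * d.factorial) / 4 ^ (b + d)) := by gcongr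
    _ = γ * (b.factorial / 2 ^ b) * (γ * (d.factorial / 2 ^ d)) := by
        rw [show (4 : ℝ) = 2 * 2 by norm_num, mul_pow, pow_add]
        field_simp
    _ ≤ _ := mul_le_mul hbelow habove (by positivity) (le_trans (by positivity) hbelow)

theorem exp_le_factorial_div_pow {η : ℝ} (hη0 : 0 < η) (hη1 : η ≤ 1) {N K : ℕ} (hN : 0 < N)
    (hK : (K : ℝ) ≤ η * N) :
    Real.exp (-(η + Real.negMulLog η) * N) ≤ K.factorial / (N : ℝ) ^ K := by
  have hpow : η ^ K * (N : ℝ) ^ K ≤ Real.exp (η * N) * K.factorial := by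
    rw [← mul_pow, ← div_le_iff₀ (Nat.cast_pos.mpr K.factorial_pos)]
    exact Real.pow_div_factorial_le_exp _ (by positivity) _
  have hlog : Real.exp (Real.log η * (η * N)) ≤ η ^ K := by
    rw [← Real.rpow_natCast, Real.rpow_def_of_pos hη0]
    exact Real.exp_le_exp.mpr (mul_le_mul_of_nonpos_left hK (Real.log_nonpos hη0.le hη1))
  rw [le_div_iff₀ (by positivity)]
  calc Real.exp (-(η + Real.negMulLog η) * N) * (N : ℝ) ^ K
      = Real.exp (-(η * N)) * (Real.exp (Real.log η * (η * N)) * (N : ℝ) ^ K) := by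
        rw [← mul_assoc, ← Real.exp_add, Real.negMulLog]
        ring_nf
    _ ≤ Real.exp (-(η * N)) * (η ^ K * (N : ℝ) ^ K) := by gcongr
    _ ≤ Real.exp (-(η * N)) * (Real.exp (η * N) * K.factorial) := by gcongr
    _ = K.factorial := by rw [← mul_assoc, ← Real.exp_add, neg_add_cancel, Real.exp_zero, one_mul]

theorem exp_le_sq_factorial_div_pow {η δ : ℝ} (hη0 : 0 < η) (hη1 : η ≤ 1)
    (hδ : 2 * (η + Real.negMulLog η) ≤ δ) {N K : ℕ} (hN : 0 < N) (hK : (K : ℝ) ≤ η * N) :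
    Real.exp (-(δ * N)) ≤ (K.factorial / (N : ℝ) ^ K) ^ 2 :=
  calc Real.exp (-(δ * N)) ≤ Real.exp (-(2 * (η + Real.negMulLog η) * N)) := by gcongr
    _ = Real.exp (-(η + Real.negMulLog η) * N) ^ 2 := by
        rw [← Real.exp_nat_mul]
        push_cast
        ring_nf
    _ ≤ _ := pow_le_pow_left₀ (Real.exp_pos _).le (exp_le_factorial_div_pow hη0 hη1 hN hK) 2

theorem prod_succ_div (N K : ℕ) :
    ∏ s ∈ range K, ((s + 1 : ℕ) : ℝ) / N = K.factorial / (N : ℝ) ^ K := by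
  rw [prod_div_distrib, prod_const, card_range, ← prod_range_add_one_eq_factorial, Nat.cast_prod]

theorem exp_le_habiroProd_one {η δ : ℝ} (hη0 : 0 < η) (hη1 : η ≤ 1 / 2)
    (hδ : 2 * (η + Real.negMulLog η) ≤ δ) {N K : ℕ} (hN : 0 < N) (hK : (K : ℝ) ≤ η * N) :
    Real.exp (-(δ * N)) ≤ habiroProd 1 N K := by
  have hN' : (0 : ℝ) < N := Nat.cast_pos.mpr hN
  refine (exp_le_sq_factorial_div_pow hη0 (by linarith) hδ hN hK).trans ?_
  rw [← prod_succ_div, ← prod_pow]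
  refine prod_le_prod (fun _ _ => by positivity) fun s hs => ?_
  have hs' : ((s + 1 : ℕ) : ℝ) ≤ K := Nat.cast_le.mpr (mem_range.mp hs)
  have hhalf : |((s + 1 : ℕ) : ℝ) / N| ≤ 1 / 2 := by
    rw [abs_of_nonneg (by positivity), div_le_iff₀ hN']
    nlinarith
  have hsin := pow_le_pow_left₀ (by positivity) (two_mul_abs_le_abs_sin_pi_mul hhalf) 2
  rw [mul_pow, sq_abs, sq_abs] at hsin
  rw [habiroFactor_one]
  linarith [sq_nonneg (((s + 1 : ℕ) : ℝ) / N)]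

/-- The zero, in general not an integer, of `habiroFactor r N k` as a function of a real index `k`
near the origin. -/
def vanishingIndex (r : ℝ) (N : ℕ) : ℝ := |r - 1| / r * N

theorem habiroFactor_eq_sin_mul_sin (r : ℝ) (N k : ℕ) :
    habiroFactor r N k = 4 * (Real.sin (Real.pi * (r * (k / N) + (r - 1))) *
      Real.sin (Real.pi * (r * (k / N) - (r - 1)))) := by
  have hperiod : Real.sin (Real.pi * r) ^ 2 = Real.sin (Real.pi * (r - 1)) ^ 2 := by
    rw [mul_sub, mul_one, Real.sin_sub_pi, neg_sq]
  rw [habiroFactor, hperiod, mul_add, mul_sub Real.pi (r * (k / N)), Real.sin_add, Real.sin_sub,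
    ← mul_assoc Real.pi r]
  linear_combination (-4 * Real.sin (Real.pi * r * (k / N)) ^ 2) *
    Real.sin_sq_add_cos_sq (Real.pi * (r - 1)) + 4 * Real.sin (Real.pi * (r - 1)) ^ 2 *
    Real.sin_sq_add_cos_sq (Real.pi * r * (k / N))

theorem sixteen_mul_abs_sq_sub_sq_le_abs_habiroFactor {r : ℝ} (hr : |r - 1| ≤ 1 / 4) {N k : ℕ}
    (hN : 0 < N) (hk : 12 * k ≤ N) :
    16 * |(r * (k / N)) ^ 2 - (r - 1) ^ 2| ≤ |habiroFactor r N k| := by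
  obtain ⟨hr_lower, hr_upper⟩ := abs_le.mp hr
  have hx : (k : ℝ) / N ≤ 1 / 12 := by
    rw [div_le_div_iff₀ (Nat.cast_pos.mpr hN) (by norm_num)]
    have : (12 : ℝ) * k ≤ N := by exact_mod_cast hk
    linarith
  have hx0 : 0 ≤ (k : ℝ) / N := by positivity
  have hrx0 : 0 ≤ r * (k / N) := mul_nonneg (by linarith) hx0
  have hrx : r * (k / N) ≤ 1 / 4 := by nlinarith
  have hadd := two_mul_abs_le_abs_sin_pi_mul (x := r * (k / N) + (r - 1))
    (abs_le.mpr ⟨by linarith, by linarith⟩)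
  have hsub := two_mul_abs_le_abs_sin_pi_mul (x := r * (k / N) - (r - 1))
    (abs_le.mpr ⟨by linarith, by linarith⟩)
  have hmul := mul_le_mul hadd hsub (by positivity) (abs_nonneg _)
  rw [habiroFactor_eq_sin_mul_sin, abs_mul, abs_mul, abs_of_pos (by norm_num : (0 : ℝ) < 4),
    sq_sub_sq, abs_mul]
  linarith

theorem le_abs_habiroFactor {r : ℝ} (hr : |r - 1| ≤ 1 / 4) {N k : ℕ} (hN : 0 < N)
    (hk : 12 * k ≤ N) :
    (k : ℝ) / N * (4 * |(k : ℝ) - vanishingIndex r N| / N) ≤ |habiroFactor r N k| := by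
  have hr34 : 3 / 4 ≤ r := by linarith [(abs_le.mp hr).1]
  have hr0 : 0 < r := by linarith
  set d := |(k : ℝ) - vanishingIndex r N| with hd
  have hsub : |r * (k / N) - (|r - 1|)| = r / N * d := by
    rw [hd, ← abs_of_pos (show 0 < r / N by positivity), ← abs_mul, vanishingIndex]
    congr 1
    field_simp
  have hfactor : |(r * (k / N)) ^ 2 - (r - 1) ^ 2| = (r * (k / N) + |r - 1|) * (r / N * d) := by
    rw [← hsub, ← sq_abs (r - 1), sq_sub_sq, abs_mul, abs_of_nonneg (by positivity)]
  refine le_trans ?_ (sixteen_mul_abs_sq_sub_sq_le_abs_habiroFactor hr hN hk)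
  rw [hfactor]
  calc (k : ℝ) / N * (4 * d / N) = 4 * (k / N * (d / N)) := by ring
    _ ≤ 16 * (r * r) * (k / N * (d / N)) := by
        refine mul_le_mul_of_nonneg_right (by nlinarith) (by positivity)
    _ = 16 * ((r * (k / N)) * (r / N * d)) := by ring
    _ ≤ 16 * ((r * (k / N) + |r - 1|) * (r / N * d)) := by
        gcongr
        exact le_add_of_nonneg_right (abs_nonneg _)

theorem le_abs_habiroProd {r γ η δ : ℝ} (hr : |r - 1| ≤ 1 / 4) (hη0 : 0 < η) (hη1 : η ≤ 1 / 12)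
    (hδ : 2 * (η + Real.negMulLog η) ≤ δ) (hγ : 0 ≤ γ) {N K : ℕ} (hN : 0 < N)
    (hK : (K : ℝ) ≤ η * N) (hv : vanishingIndex r N ≤ K)
    (hfract : Int.fract (vanishingIndex r N) ∈ Set.Icc γ (1 - γ)) :
    γ ^ 2 * Real.exp (-(δ * N)) ≤ |habiroProd r N K| := by
  have hr0 : 0 < r := by linarith [(abs_le.mp hr).1]
  have hv0 : 0 ≤ vanishingIndex r N := by
    rw [vanishingIndex]
    positivity
  have hprod := sq_mul_factorial_div_four_pow_le_prod_abs_sub hγ hv0 hfract hv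
  calc γ ^ 2 * Real.exp (-(δ * N))
      ≤ γ ^ 2 * (K.factorial / (N : ℝ) ^ K) ^ 2 := by
        gcongr
        exact exp_le_sq_factorial_div_pow hη0 (by linarith) hδ hN hK
    _ = (K.factorial / (N : ℝ) ^ K) *
        (4 ^ K * (γ ^ 2 * (K.factorial / 4 ^ K)) / (N : ℝ) ^ K) := by field_simp
    _ ≤ (K.factorial / (N : ℝ) ^ K) *
        (4 ^ K * (∏ s ∈ range K, |((s + 1 : ℕ) : ℝ) - vanishingIndex r N|) / (N : ℝ) ^ K) := by
        gcongr
    _ = ∏ s ∈ range K, ((s + 1 : ℕ) : ℝ) / N *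
          (4 * |((s + 1 : ℕ) : ℝ) - vanishingIndex r N| / N) := by
        rw [prod_mul_distrib, prod_succ_div, prod_div_distrib, prod_mul_distrib, prod_const,
          prod_const, card_range]
    _ ≤ |habiroProd r N K| := by
        rw [habiroProd, abs_prod]
        refine prod_le_prod (fun _ _ => by positivity) fun s hs => le_abs_habiroFactor hr hN ?_
        have hs' : ((s + 1 : ℕ) : ℝ) ≤ K := Nat.cast_le.mpr (mem_range.mp hs)
        have : (12 : ℝ) * ((s + 1 : ℕ) : ℝ) ≤ N := by nlinarith
        exact_mod_cast this

theorem abs_habiroProd_le_one {r : ℝ} (hr : |r - 1| ≤ 1 / 1280) {N m : ℕ} (hm : 12 * m ≤ N) :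
    |habiroProd r N m| ≤ 1 := by
  rw [habiroProd, abs_prod]
  refine prod_le_one (fun _ _ => abs_nonneg _) fun s hs => ?_
  rw [mem_range] at hs
  linarith [abs_habiroFactor_le_half hr (N := N) (k := s + 1) (by omega) (by omega)
    (Or.inl (by omega))]

/-- The product of the factors with index in `(K, m]`, the quotient of the `m`-th summand of the
cyclotomic expansion by the `K`-th one. -/
def bulkProd (r : ℝ) (N K m : ℕ) : ℝ := ∏ s ∈ Ico K m, habiroFactor r N (s + 1)

/-- The sum of the summands with index in `[K, L]` of the cyclotomic expansion, divided by the
`K`-th summand. -/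
def bulkSum (r : ℝ) (N K L : ℕ) : ℝ := ∑ m ∈ Ico K (L + 1), bulkProd r N K m

/-- `K` and `L` are the integral parts of `η N` and `(1 - η) N`, so that the factors at `r = 1`
whose index lies between them are bounded away from zero, and `N` is so large that the summands of
the cyclotomic expansion with index above `L` are negligible. -/
structure IsBulk (η : ℝ) (N K L : ℕ) : Prop where
  eta_pos : 0 < η
  eta_le : η ≤ 1 / 24
  large : 24 ≤ N
  lower_le : (K : ℝ) ≤ η * N
  lt_lower_add_one : η * N < K + 1
  upper_le : (L : ℝ) ≤ (1 - η) * N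
  lt_upper_add_one : (1 - η) * N < L + 1
  mul_half_pow_le : (N : ℝ) * (1 / 2) ^ (L - 11 * N / 12) ≤ 1 / 4

theorem tendsto_mul_half_pow_div :
    Tendsto (fun N : ℕ => (N : ℝ) * (1 / 2) ^ (N / 24)) atTop (𝓝 0) := by
  have hbound : Tendsto (fun q : ℕ => 24 * ((q : ℝ) * (1 / 2) ^ q) + 23 * (1 / 2) ^ q) atTop
      (𝓝 (24 * 0 + 23 * 0)) :=
    ((tendsto_self_mul_const_pow_of_lt_one (by norm_num) (by norm_num)).const_mul 24).add
      ((tendsto_pow_atTop_nhds_zero_of_lt_one (by norm_num) (by norm_num)).const_mul 23)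
  rw [mul_zero, mul_zero, add_zero] at hbound
  refine squeeze_zero (fun N => by positivity) (fun N => ?_)
    (hbound.comp (Nat.tendsto_div_const_atTop (by norm_num : 24 ≠ 0)))
  have hN : (N : ℝ) ≤ 24 * ((N / 24 : ℕ) : ℝ) + 23 := by
    exact_mod_cast (show N ≤ 24 * (N / 24) + 23 by omega)
  calc (N : ℝ) * (1 / 2) ^ (N / 24) ≤ (24 * ((N / 24 : ℕ) : ℝ) + 23) * (1 / 2) ^ (N / 24) := by
        gcongr
    _ = 24 * (((N / 24 : ℕ) : ℝ) * (1 / 2) ^ (N / 24)) + 23 * (1 / 2) ^ (N / 24) := by ring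

theorem lt_twenty_four_mul_add_one {η : ℝ} (hη : η ≤ 1 / 24) {N L : ℕ}
    (hL : (1 - η) * N < L + 1) : 23 * N < 24 * (L + 1) := by
  have : (23 : ℝ) * N < 24 * (L + 1) := by nlinarith [N.cast_nonneg (α := ℝ)]
  exact_mod_cast this

theorem eventually_isBulk {η : ℝ} (hη0 : 0 < η) (hη1 : η ≤ 1 / 24) :
    ∀ᶠ N : ℕ in atTop, ∃ K L, IsBulk η N K L := by
  filter_upwards [eventually_ge_atTop 24, tendsto_mul_half_pow_div.eventually_le_const
    (show (0 : ℝ) < 1 / 4 by norm_num)] with N hN hsmall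
  have hupper := lt_twenty_four_mul_add_one hη1 (Nat.lt_floor_add_one ((1 - η) * N))
  exact ⟨⌊η * N⌋₊, ⌊(1 - η) * N⌋₊,
    { eta_pos := hη0
      eta_le := hη1
      large := hN
      lower_le := Nat.floor_le (by positivity)
      lt_lower_add_one := Nat.lt_floor_add_one _
      upper_le := Nat.floor_le (mul_nonneg (by linarith) (Nat.cast_nonneg N))
      lt_upper_add_one := Nat.lt_floor_add_one _
      mul_half_pow_le := (mul_le_mul_of_nonneg_left (pow_le_pow_of_le_one (by norm_num)
        (by norm_num) (by omega)) (Nat.cast_nonneg N)).trans hsmall }⟩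

namespace IsBulk

variable {η : ℝ} {N K L : ℕ}

theorem pos (hb : IsBulk η N K L) : 0 < N :=
  (Nat.succ_pos 23).trans_le hb.large

theorem upper_lt (hb : IsBulk η N K L) : L < N := by
  have hN : (0 : ℝ) < N := Nat.cast_pos.mpr hb.pos
  have : (L : ℝ) < N := by nlinarith [hb.upper_le, hb.eta_pos]
  exact_mod_cast this

theorem twelve_mul_lower_le (hb : IsBulk η N K L) : 12 * K ≤ N := by
  have hN : (0 : ℝ) < N := Nat.cast_pos.mpr hb.pos
  have : (12 : ℝ) * K ≤ N := by nlinarith [hb.lower_le, hb.eta_le]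
  exact_mod_cast this

theorem eleven_mul_div_twelve_le_upper (hb : IsBulk η N K L) : 11 * N / 12 ≤ L := by
  have hupper := lt_twenty_four_mul_add_one hb.eta_le hb.lt_upper_add_one
  omega

theorem abs_habiroFactor_sub_le_mul (hb : IsBulk η N K L) {κ r : ℝ}
    (hκ : 4 * |r - 1| ≤ κ * η ^ 2) (hκ0 : 0 ≤ κ) {s : ℕ} (hs : s ∈ Ico K L) :
    |habiroFactor r N (s + 1) - habiroFactor 1 N (s + 1)| ≤ κ * habiroFactor 1 N (s + 1) := by
  obtain ⟨hKs, hsL⟩ := mem_Ico.mp hs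
  refine ColoredJones.abs_habiroFactor_sub_le_mul hb.eta_pos.le hκ hκ0 hb.pos
    (hsL.trans hb.upper_lt) ?_ ?_
  · have : (K : ℝ) + 1 ≤ ((s + 1 : ℕ) : ℝ) := by exact_mod_cast Nat.succ_le_succ hKs
    linarith [hb.lt_lower_add_one]
  · exact (Nat.cast_le.mpr hsL).trans hb.upper_le

end IsBulk

theorem habiroProd_mul_bulkProd (r : ℝ) (N : ℕ) {K m : ℕ} (h : K ≤ m) :
    habiroProd r N K * bulkProd r N K m = habiroProd r N m :=
  prod_range_mul_prod_Ico _ h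

theorem bulkProd_one_nonneg (N K m : ℕ) : 0 ≤ bulkProd 1 N K m :=
  prod_nonneg fun _ _ => habiroFactor_one_nonneg _ _

theorem bulkSum_one_nonneg (N K L : ℕ) : 0 ≤ bulkSum 1 N K L :=
  sum_nonneg fun _ _ => bulkProd_one_nonneg _ _ _

section Comparison

variable {η κ r : ℝ} {N K L : ℕ}

theorem IsBulk.pow_mul_bulkProd_one_le (hb : IsBulk η N K L)
    (hκ : 4 * |r - 1| ≤ κ * η ^ 2) (hκ0 : 0 ≤ κ) (hκ1 : κ ≤ 1) {m : ℕ} (hm : m ≤ L) :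
    (1 - κ) ^ N * bulkProd 1 N K m ≤ bulkProd r N K m := by
  have hmN := hm.trans_lt hb.upper_lt
  calc (1 - κ) ^ N * bulkProd 1 N K m ≤ (1 - κ) ^ (m - K) * bulkProd 1 N K m := by
        refine mul_le_mul_of_nonneg_right ?_ (bulkProd_one_nonneg _ _ _)
        exact pow_le_pow_of_le_one (by linarith) (by linarith) (by omega)
    _ = ∏ s ∈ Ico K m, (1 - κ) * habiroFactor 1 N (s + 1) := by
        rw [prod_mul_distrib, prod_const, Nat.card_Ico, bulkProd]
    _ ≤ bulkProd r N K m := by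
        refine prod_le_prod
          (fun s _ => mul_nonneg (by linarith) (habiroFactor_one_nonneg _ _)) fun s hs => ?_
        have := hb.abs_habiroFactor_sub_le_mul hκ hκ0 (Ico_subset_Ico_right hm hs)
        linarith [(abs_le.mp this).1]

theorem IsBulk.bulkProd_nonneg (hb : IsBulk η N K L)
    (hκ : 4 * |r - 1| ≤ κ * η ^ 2) (hκ0 : 0 ≤ κ) (hκ1 : κ ≤ 1) {m : ℕ} (hm : m ≤ L) :
    0 ≤ bulkProd r N K m :=
  (mul_nonneg (pow_nonneg (sub_nonneg.mpr hκ1) _) (bulkProd_one_nonneg _ _ _)).trans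
    (hb.pow_mul_bulkProd_one_le hκ hκ0 hκ1 hm)

theorem IsBulk.bulkProd_le_pow_mul (hb : IsBulk η N K L)
    (hκ : 4 * |r - 1| ≤ κ * η ^ 2) (hκ0 : 0 ≤ κ) (hκ1 : κ ≤ 1) {m : ℕ} (hm : m ≤ L) :
    bulkProd r N K m ≤ (1 + κ) ^ N * bulkProd 1 N K m := by
  have hmN := hm.trans_lt hb.upper_lt
  have hfactor : ∀ s ∈ Ico K m, |habiroFactor r N (s + 1) - habiroFactor 1 N (s + 1)| ≤
      κ * habiroFactor 1 N (s + 1) := fun s hs =>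
    hb.abs_habiroFactor_sub_le_mul hκ hκ0 (Ico_subset_Ico_right hm hs)
  calc bulkProd r N K m ≤ ∏ s ∈ Ico K m, (1 + κ) * habiroFactor 1 N (s + 1) := by
        refine prod_le_prod (fun s hs => ?_) fun s hs => ?_
        · have := mul_nonneg (sub_nonneg.mpr hκ1) (habiroFactor_one_nonneg N (s + 1))
          linarith [(abs_le.mp (hfactor s hs)).1]
        · linarith [(abs_le.mp (hfactor s hs)).2]
    _ = (1 + κ) ^ (m - K) * bulkProd 1 N K m := by
        rw [prod_mul_distrib, prod_const, Nat.card_Ico, bulkProd]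
    _ ≤ (1 + κ) ^ N * bulkProd 1 N K m := by
        refine mul_le_mul_of_nonneg_right ?_ (bulkProd_one_nonneg _ _ _)
        exact pow_le_pow_right₀ (by linarith) (by omega)

theorem IsBulk.pow_mul_bulkSum_one_le (hb : IsBulk η N K L)
    (hκ : 4 * |r - 1| ≤ κ * η ^ 2) (hκ0 : 0 ≤ κ) (hκ1 : κ ≤ 1) :
    (1 - κ) ^ N * bulkSum 1 N K L ≤ bulkSum r N K L := by
  rw [bulkSum, mul_sum, bulkSum]
  exact sum_le_sum fun m hm =>
    hb.pow_mul_bulkProd_one_le hκ hκ0 hκ1 (Nat.lt_succ_iff.mp (mem_Ico.mp hm).2)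

theorem IsBulk.bulkSum_le_pow_mul (hb : IsBulk η N K L)
    (hκ : 4 * |r - 1| ≤ κ * η ^ 2) (hκ0 : 0 ≤ κ) (hκ1 : κ ≤ 1) :
    bulkSum r N K L ≤ (1 + κ) ^ N * bulkSum 1 N K L := by
  rw [bulkSum, bulkSum, mul_sum]
  exact sum_le_sum fun m hm =>
    hb.bulkProd_le_pow_mul hκ hκ0 hκ1 (Nat.lt_succ_iff.mp (mem_Ico.mp hm).2)

theorem IsBulk.bulkSum_nonneg (hb : IsBulk η N K L)
    (hκ : 4 * |r - 1| ≤ κ * η ^ 2) (hκ0 : 0 ≤ κ) (hκ1 : κ ≤ 1) : 0 ≤ bulkSum r N K L :=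
  sum_nonneg fun _ hm =>
    hb.bulkProd_nonneg hκ hκ0 hκ1 (Nat.lt_succ_iff.mp (mem_Ico.mp hm).2)

theorem IsBulk.bulkProd_le_bulkSum (hb : IsBulk η N K L)
    (hκ : 4 * |r - 1| ≤ κ * η ^ 2) (hκ0 : 0 ≤ κ) (hκ1 : κ ≤ 1) {m : ℕ} (hKm : K ≤ m)
    (hmL : m ≤ L) : bulkProd r N K m ≤ bulkSum r N K L :=
  single_le_sum (f := bulkProd r N K)
    (fun _ hm => hb.bulkProd_nonneg hκ hκ0 hκ1 (Nat.lt_succ_iff.mp (mem_Ico.mp hm).2))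
    (mem_Ico.mpr ⟨hKm, Nat.lt_succ_of_le hmL⟩)

end Comparison

theorem habiroSum_eq_add_add (r : ℝ) {N K L : ℕ} (hKL : K ≤ L) (hLN : L < N) :
    habiroSum r N = ∑ m ∈ range K, habiroProd r N m +
      habiroProd r N K * bulkSum r N K L + ∑ m ∈ Ico (L + 1) N, habiroProd r N m := by
  rw [habiroSum, ← sum_range_add_sum_Ico _ (show K ≤ N by omega),
    ← sum_Ico_consecutive _ (show K ≤ L + 1 by omega) (show L + 1 ≤ N by omega), ← add_assoc,
    bulkSum, mul_sum]
  congr 2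
  exact sum_congr rfl fun m hm => (habiroProd_mul_bulkProd r N (mem_Ico.mp hm).1).symm

theorem abs_sum_range_habiroProd_le {r : ℝ} (hr : |r - 1| ≤ 1 / 1280) {N K : ℕ}
    (hK : 12 * K ≤ N) : |∑ m ∈ range K, habiroProd r N m| ≤ N :=
  calc |∑ m ∈ range K, habiroProd r N m| ≤ ∑ m ∈ range K, |habiroProd r N m| :=
        abs_sum_le_sum_abs _ _
    _ ≤ ∑ _m ∈ range K, (1 : ℝ) := sum_le_sum fun m hm => by
        rw [mem_range] at hm
        exact abs_habiroProd_le_one hr (by omega)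
    _ = K := by rw [sum_const, card_range, nsmul_one]
    _ ≤ N := Nat.cast_le.mpr (by omega)

theorem abs_habiroProd_le_mul_half_pow {r : ℝ} (hr : |r - 1| ≤ 1 / 1280) {N m m' : ℕ}
    (hm : 11 * N < 12 * (m + 1)) (hmm' : m ≤ m') (hm' : m' ≤ N) :
    |habiroProd r N m'| ≤ |habiroProd r N m| * (1 / 2) ^ (m' - m) := by
  rw [← habiroProd_mul_bulkProd r N hmm', abs_mul]
  refine mul_le_mul_of_nonneg_left ?_ (abs_nonneg _)
  rw [bulkProd, abs_prod, ← Nat.card_Ico, ← prod_const]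
  refine prod_le_prod (fun _ _ => abs_nonneg _) fun s hs => ?_
  rw [mem_Ico] at hs
  exact abs_habiroFactor_le_half hr (by omega) (by omega) (Or.inr (by omega))

theorem abs_sum_Ico_habiroProd_le {r : ℝ} (hr : |r - 1| ≤ 1 / 1280) {N m L : ℕ}
    (hm : 11 * N < 12 * (m + 1)) (hmL : m ≤ L) :
    |∑ l ∈ Ico (L + 1) N, habiroProd r N l| ≤ |habiroProd r N m| * (N * (1 / 2) ^ (L - m)) :=
  calc |∑ l ∈ Ico (L + 1) N, habiroProd r N l| ≤ ∑ l ∈ Ico (L + 1) N, |habiroProd r N l| :=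
        abs_sum_le_sum_abs _ _
    _ ≤ ∑ _l ∈ Ico (L + 1) N, |habiroProd r N m| * (1 / 2) ^ (L - m) := sum_le_sum fun l hl => by
        rw [mem_Ico] at hl
        refine (abs_habiroProd_le_mul_half_pow hr hm (show m ≤ l by omega) (by omega)).trans ?_
        exact mul_le_mul_of_nonneg_left
          (pow_le_pow_of_le_one (by norm_num) (by norm_num) (by omega)) (abs_nonneg _)
    _ = ((N - (L + 1) : ℕ) : ℝ) * (|habiroProd r N m| * (1 / 2) ^ (L - m)) := by
        rw [sum_const, Nat.card_Ico, nsmul_eq_mul]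
    _ ≤ N * (|habiroProd r N m| * (1 / 2) ^ (L - m)) :=
        mul_le_mul_of_nonneg_right (Nat.cast_le.mpr (Nat.sub_le _ _)) (by positivity)
    _ = |habiroProd r N m| * (N * (1 / 2) ^ (L - m)) := by ring

theorem IsBulk.abs_habiroSum_sub_le {η κ r : ℝ} {N K L : ℕ} (hb : IsBulk η N K L)
    (hr : |r - 1| ≤ 1 / 1280) (hκ : 4 * |r - 1| ≤ κ * η ^ 2) (hκ0 : 0 ≤ κ) (hκ1 : κ ≤ 1) :
    |habiroSum r N - habiroProd r N K * bulkSum r N K L| ≤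
      N + 1 / 4 * |habiroProd r N K * bulkSum r N K L| := by
  have hK := hb.twelve_mul_lower_le
  have hmL := hb.eleven_mul_div_twelve_le_upper
  have hlarge := hb.large
  set m := 11 * N / 12
  have hKm : K ≤ m := by omega
  have hmid : |habiroProd r N m| ≤ |habiroProd r N K * bulkSum r N K L| := by
    rw [← habiroProd_mul_bulkProd r N hKm, abs_mul, abs_mul]
    exact mul_le_mul_of_nonneg_left (abs_le_abs_of_nonneg (hb.bulkProd_nonneg hκ hκ0 hκ1 hmL)
      (hb.bulkProd_le_bulkSum hκ hκ0 hκ1 hKm hmL)) (abs_nonneg _)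
  have htail : |∑ l ∈ Ico (L + 1) N, habiroProd r N l| ≤
      1 / 4 * |habiroProd r N K * bulkSum r N K L| := by
    refine (abs_sum_Ico_habiroProd_le hr (by omega) hmL).trans ?_
    rw [mul_comm (1 / 4)]
    exact mul_le_mul hmid hb.mul_half_pow_le (by positivity) (abs_nonneg _)
  rw [habiroSum_eq_add_add r (hKm.trans hmL) hb.upper_lt, add_right_comm, add_sub_cancel_right]
  exact (abs_add_le _ _).trans (add_le_add (abs_sum_range_habiroProd_le hr hK) htail)

theorem exp_mul_one_sub_inv_le_pow {x : ℝ} (hx : 0 < x) (n : ℕ) :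
    Real.exp (n * (1 - x⁻¹)) ≤ x ^ n := by
  rw [Real.exp_nat_mul]
  exact pow_le_pow_left₀ (Real.exp_pos _).le
    ((Real.le_log_iff_exp_le hx).mp (Real.one_sub_inv_le_log_of_pos hx)) n

theorem sq_mul_habiroFactor_one_le {N k : ℕ} (hN : 0 < N) (hk : k ≤ N) :
    ((N : ℝ) / (N + 1)) ^ 2 * habiroFactor 1 N k ≤ habiroFactor 1 (N + 1) k := by
  have hpi := Real.pi_pos
  have hangle0 : 0 ≤ Real.pi * (k / N) := by positivity
  have hangle1 : Real.pi * (k / N) ≤ Real.pi :=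
    mul_le_of_le_one_right hpi.le (natCast_div_le_one hk)
  have hsin := mul_sin_le_sin_mul (c := (N : ℝ) / (N + 1)) (by positivity)
    (div_le_one_of_le₀ (by linarith) (by positivity)) hangle0 hangle1
  have hscale : (N : ℝ) / (N + 1) * (Real.pi * (k / N)) = Real.pi * (k / (N + 1 : ℕ)) := by
    push_cast
    field_simp
  rw [hscale] at hsin
  have hsq := pow_le_pow_left₀ (mul_nonneg (by positivity)
    (Real.sin_nonneg_of_nonneg_of_le_pi hangle0 hangle1)) hsin 2
  rw [mul_pow] at hsq
  rw [habiroFactor_one, habiroFactor_one]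
  linarith

theorem exp_neg_two_mul_habiroProd_one_le {N m : ℕ} (hN : 0 < N) (hm : m ≤ N) :
    Real.exp (-2) * habiroProd 1 N m ≤ habiroProd 1 (N + 1) m := by
  have hexp : Real.exp (-1) ≤ ((N : ℝ) / (N + 1)) ^ N := by
    refine le_of_eq_of_le ?_ (exp_mul_one_sub_inv_le_pow (by positivity) N)
    congr 1
    field_simp
    ring
  calc Real.exp (-2) * habiroProd 1 N m
      = Real.exp (-1) ^ 2 * habiroProd 1 N m := by
        rw [← Real.exp_nat_mul]
        norm_num
    _ ≤ (((N : ℝ) / (N + 1)) ^ m) ^ 2 * habiroProd 1 N m := by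
        refine mul_le_mul_of_nonneg_right (pow_le_pow_left₀ (Real.exp_pos _).le (hexp.trans ?_) 2)
          (habiroProd_one_nonneg N m)
        exact pow_le_pow_of_le_one (by positivity)
          (div_le_one_of_le₀ (by linarith) (by positivity)) hm
    _ = ∏ s ∈ range m, ((N : ℝ) / (N + 1)) ^ 2 * habiroFactor 1 N (s + 1) := by
        rw [prod_mul_distrib, prod_const, card_range, ← pow_mul, ← pow_mul, mul_comm m, habiroProd]
    _ ≤ habiroProd 1 (N + 1) m :=
        prod_le_prod (fun _ _ => mul_nonneg (by positivity) (habiroFactor_one_nonneg _ _))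
          fun s hs => sq_mul_habiroFactor_one_le hN ((mem_range.mp hs).trans_le hm)

theorem exp_neg_two_mul_habiroSum_one_le {N : ℕ} (hN : 0 < N) :
    Real.exp (-2) * habiroSum 1 N ≤ habiroSum 1 (N + 1) := by
  rw [habiroSum, habiroSum, mul_sum, sum_range_succ]
  exact le_add_of_le_of_nonneg (sum_le_sum fun m hm =>
    exp_neg_two_mul_habiroProd_one_le hN (mem_range.mp hm).le) (habiroProd_one_nonneg _ _)

theorem habiroProd_one_le_habiroSum_one {N m : ℕ} (hm : m < N) :
    habiroProd 1 N m ≤ habiroSum 1 N :=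
  single_le_sum (f := habiroProd 1 N) (fun m _ => habiroProd_one_nonneg N m) (mem_range.mpr hm)

theorem one_le_habiroSum_one {N : ℕ} (hN : 0 < N) : 1 ≤ habiroSum 1 N := by
  simpa [habiroProd] using habiroProd_one_le_habiroSum_one hN

theorem habiroSum_one_le (N : ℕ) : habiroSum 1 N ≤ N * 4 ^ N := by
  have hprod : ∀ m ∈ range N, habiroProd 1 N m ≤ 4 ^ N := fun m hm =>
    calc habiroProd 1 N m ≤ ∏ _s ∈ range m, (4 : ℝ) :=
          prod_le_prod (fun _ _ => habiroFactor_one_nonneg _ _) fun s _ => by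
            rw [habiroFactor_one]
            linarith [Real.sin_sq_le_one (Real.pi * (((s + 1 : ℕ) : ℝ) / N))]
      _ = 4 ^ m := by rw [prod_const, card_range]
      _ ≤ 4 ^ N := pow_le_pow_right₀ (by norm_num) (mem_range.mp hm).le
  simpa [habiroSum] using sum_le_card_nsmul _ _ _ hprod

theorem habiroProd_one_self (n : ℕ) : habiroProd 1 (n + 1) n = ((n + 1 : ℕ) : ℝ) ^ 2 := by
  have hroots := congrArg (fun z : ℂ => ‖z‖ ^ 2)
    (Complex.isPrimitiveRoot_exp (n + 1) n.succ_ne_zero).prod_one_sub_pow_eq_order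
  rw [← Nat.cast_succ, Complex.norm_natCast] at hroots
  simp only [norm_prod, ← prod_pow] at hroots
  rw [← hroots, habiroProd]
  refine prod_congr rfl fun s _ => ?_
  have hexp : Complex.exp (2 * Real.pi * Complex.I / (n + 1 : ℕ)) ^ (s + 1) =
      Complex.exp (Complex.I * (2 * (Real.pi * ((s + 1 : ℕ) / (n + 1 : ℕ))) : ℝ)) := by
    rw [← Complex.exp_nat_mul]
    congr 1
    push_cast
    ring
  rw [hexp, norm_sub_rev, Complex.norm_exp_I_mul_ofReal_sub_one, habiroFactor_one,
    Real.norm_eq_abs, sq_abs, mul_div_cancel_left₀ _ (two_ne_zero' ℝ)]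
  ring

theorem exp_log_two_div_twelve_le {N d : ℕ} (h : N ≤ 12 * (d + 1)) :
    Real.exp (Real.log 2 / 12 * N) ≤ 2 ^ (d + 1) := by
  have hcast : (N : ℝ) ≤ 12 * ((d + 1 : ℕ) : ℝ) := by exact_mod_cast h
  rw [← Real.rpow_natCast, Real.rpow_def_of_pos two_pos, Real.exp_le_exp]
  linarith [mul_le_mul_of_nonneg_left hcast (Real.log_pos one_lt_two).le]

theorem exp_le_habiroSum_one {N : ℕ} (hN : 2 ≤ N) :
    Real.exp (Real.log 2 / 12 * N) ≤ habiroSum 1 N := by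
  obtain ⟨n, rfl⟩ : ∃ n, N = n + 1 := Nat.exists_eq_succ_of_ne_zero (by omega)
  set m := 11 * (n + 1) / 12
  have hmn : m ≤ n := by omega
  have hhalf := abs_habiroProd_le_mul_half_pow (r := 1) (by simp) (N := n + 1) (m := m)
    (m' := n) (by omega) hmn n.le_succ
  rw [abs_of_nonneg (habiroProd_one_nonneg _ _), abs_of_nonneg (habiroProd_one_nonneg _ _),
    habiroProd_one_self, one_div, inv_pow, ← div_eq_mul_inv, le_div_iff₀ (by positivity)] at hhalf
  have hsq : (2 : ℝ) ≤ ((n + 1 : ℕ) : ℝ) ^ 2 := by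
    have : (2 : ℝ) ≤ ((n + 1 : ℕ) : ℝ) := Nat.ofNat_le_cast.mpr hN
    nlinarith
  calc Real.exp (Real.log 2 / 12 * (n + 1 : ℕ)) ≤ 2 ^ (n - m + 1) :=
        exp_log_two_div_twelve_le (by omega)
    _ = 2 * 2 ^ (n - m) := pow_succ' _ _
    _ ≤ ((n + 1 : ℕ) : ℝ) ^ 2 * 2 ^ (n - m) := by gcongr
    _ ≤ habiroProd 1 (n + 1) m := hhalf
    _ ≤ habiroSum 1 (n + 1) := habiroProd_one_le_habiroSum_one (by omega)

theorem exists_add_negMulLog_le {δ : ℝ} (hδ : 0 < δ) :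
    ∃ η : ℝ, 0 < η ∧ η ≤ 1 / 24 ∧ 2 * (η + Real.negMulLog η) ≤ δ := by
  have hcont : Continuous fun η : ℝ => 2 * (η + Real.negMulLog η) := by fun_prop
  have hlim := (hcont.tendsto 0).mono_left (nhdsWithin_le_nhds (s := Set.Ioi 0))
  obtain ⟨η, ⟨hη, hη0⟩, hη1⟩ := ((hlim.eventually_le_const (by simpa using hδ)).and
    self_mem_nhdsWithin |>.and ((eventually_le_nhds (show (0 : ℝ) < 1 / 24 by norm_num)).filter_mono
      nhdsWithin_le_nhds)).exists
  exact ⟨η, hη0, hη1, hη⟩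

theorem eventually_abs_sub_le {ρ : ℝ} (hρ : 0 < ρ) (x : ℝ) : ∀ᶠ y : ℝ in 𝓝 x, |y - x| ≤ ρ :=
  Metric.closedBall_mem_nhds x hρ

theorem eventually_mul_add_le_exp_mul {δ : ℝ} (hδ : 0 < δ) (a b : ℝ) :
    ∀ᶠ N : ℕ in atTop, a * N + b ≤ Real.exp (δ * N) := by
  have hlittle : (fun x : ℝ => a * x + b) =o[atTop] fun x => Real.exp (δ * x) := by
    simpa using ((isLittleO_pow_exp_pos_mul_atTop 1 hδ).const_mul_left a).add
      ((isLittleO_pow_exp_pos_mul_atTop 0 hδ).const_mul_left b)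
  filter_upwards [tendsto_natCast_atTop_atTop.eventually (hlittle.bound one_pos)] with N hN
  rw [one_mul, Real.norm_eq_abs, Real.norm_eq_abs, Real.abs_exp] at hN
  exact (le_abs_self _).trans hN

theorem exp_neg_two_mul_le_one_sub_pow {δ : ℝ} (hδ0 : 0 ≤ δ) (hδ1 : δ ≤ 1 / 2) (n : ℕ) :
    Real.exp (-(2 * δ * n)) ≤ (1 - δ) ^ n := by
  have hinv : (1 - δ)⁻¹ ≤ 1 + 2 * δ := by
    rw [inv_le_iff_one_le_mul₀ (by linarith)]
    nlinarith
  refine le_trans (Real.exp_le_exp.mpr ?_) (exp_mul_one_sub_inv_le_pow (by linarith) n)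
  nlinarith [n.cast_nonneg (α := ℝ)]

theorem one_add_pow_le_exp {δ : ℝ} (hδ : 0 ≤ δ) (n : ℕ) : (1 + δ) ^ n ≤ Real.exp (δ * n) := by
  rw [mul_comm, Real.exp_nat_mul, add_comm]
  exact pow_le_pow_left₀ (by linarith) (Real.add_one_le_exp δ) n

namespace IsBulk

variable {η : ℝ} {N K L : ℕ}

theorem abs_habiroSum_one_sub_le (hb : IsBulk η N K L) :
    |habiroSum 1 N - habiroProd 1 N K * bulkSum 1 N K L| ≤
      N + 1 / 4 * (habiroProd 1 N K * bulkSum 1 N K L) := by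
  have h := hb.abs_habiroSum_sub_le (r := 1) (κ := 0) (by simp) (by simp) le_rfl zero_le_one
  rwa [abs_of_nonneg (mul_nonneg (habiroProd_one_nonneg N K) (bulkSum_one_nonneg N K L))] at h

theorem habiroProd_one_mul_bulkSum_one_le (hb : IsBulk η N K L) :
    habiroProd 1 N K * bulkSum 1 N K L ≤ 4 / 3 * (habiroSum 1 N + N) := by
  linarith [(abs_le.mp hb.abs_habiroSum_one_sub_le).1]

theorem le_bulkSum_one (hb : IsBulk η N K L) :
    4 / 5 * (habiroSum 1 N - N) ≤ bulkSum 1 N K L := by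
  have hprod : habiroProd 1 N K ≤ 1 :=
    (le_abs_self _).trans (abs_habiroProd_le_one (by simp) hb.twelve_mul_lower_le)
  linarith [(abs_le.mp hb.abs_habiroSum_one_sub_le).2,
    mul_le_of_le_one_left (bulkSum_one_nonneg N K L) hprod]

theorem bulkSum_one_le (hb : IsBulk η N K L) {δ : ℝ} (hη : 2 * (η + Real.negMulLog η) ≤ δ) :
    bulkSum 1 N K L ≤ Real.exp (δ * N) * (habiroProd 1 N K * bulkSum 1 N K L) := by
  have hprod := exp_le_habiroProd_one hb.eta_pos (by linarith [hb.eta_le]) hη hb.pos hb.lower_le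
  rw [Real.exp_neg, inv_le_iff_one_le_mul₀' (Real.exp_pos _)] at hprod
  rw [← mul_assoc]
  exact le_mul_of_one_le_left (bulkSum_one_nonneg N K L) hprod

theorem abs_habiroProd_mul_bulkSum_le (hb : IsBulk η N K L) {δ r : ℝ}
    (hη : 2 * (η + Real.negMulLog η) ≤ δ) (hδ0 : 0 ≤ δ) (hδ1 : δ ≤ 1)
    (hr : |r - 1| ≤ 1 / 1280) (hrδ : 4 * |r - 1| ≤ δ * η ^ 2) :
    |habiroProd r N K * bulkSum r N K L| ≤
      Real.exp (2 * δ * N) * (habiroProd 1 N K * bulkSum 1 N K L) := by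
  have hr_nonneg := hb.bulkSum_nonneg hrδ hδ0 hδ1
  rw [abs_mul, abs_of_nonneg hr_nonneg]
  calc |habiroProd r N K| * bulkSum r N K L ≤ bulkSum r N K L :=
        mul_le_of_le_one_left hr_nonneg (abs_habiroProd_le_one hr hb.twelve_mul_lower_le)
    _ ≤ (1 + δ) ^ N * bulkSum 1 N K L := hb.bulkSum_le_pow_mul hrδ hδ0 hδ1
    _ ≤ Real.exp (δ * N) *
        (Real.exp (δ * N) * (habiroProd 1 N K * bulkSum 1 N K L)) :=
        mul_le_mul (one_add_pow_le_exp hδ0 N) (hb.bulkSum_one_le hη) (bulkSum_one_nonneg N K L)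
          (Real.exp_pos _).le
    _ = Real.exp (2 * δ * N) * (habiroProd 1 N K * bulkSum 1 N K L) := by
        rw [← mul_assoc, ← Real.exp_add]
        ring_nf

theorem abs_habiroSum_le (hb : IsBulk η N K L) {δ r : ℝ}
    (hη : 2 * (η + Real.negMulLog η) ≤ δ) (hδ0 : 0 ≤ δ) (hδ1 : δ ≤ 1)
    (hr : |r - 1| ≤ 1 / 1280) (hrδ : 4 * |r - 1| ≤ δ * η ^ 2)
    (hN : 3 * N + 2 ≤ Real.exp (2 * δ * N)) :
    |habiroSum r N| ≤ Real.exp (4 * δ * N) * habiroSum 1 N := by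
  have hsplit := abs_sub_abs_le_abs_sub (habiroSum r N) (habiroProd r N K * bulkSum r N K L)
  have herror := hb.abs_habiroSum_sub_le hr hrδ hδ0 hδ1
  have hmain := hb.abs_habiroProd_mul_bulkSum_le hη hδ0 hδ1 hr hrδ
  have hone := hb.habiroProd_one_mul_bulkSum_one_le
  have hS := one_le_habiroSum_one hb.pos
  have hexp : Real.exp (4 * δ * N) = Real.exp (2 * δ * N) * Real.exp (2 * δ * N) := by
    rw [← Real.exp_add]
    ring_nf
  have hz : 1 ≤ Real.exp (2 * δ * N) := Real.one_le_exp (by positivity)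
  rw [hexp]
  set z := Real.exp (2 * δ * N)
  set S := habiroSum 1 N
  have hzS : z ≤ z * S := le_mul_of_one_le_right (by linarith) hS
  calc |habiroSum r N| ≤ N + 5 / 4 * |habiroProd r N K * bulkSum r N K L| := by linarith
    _ ≤ N + 5 / 4 * (z * (habiroProd 1 N K * bulkSum 1 N K L)) := by gcongr
    _ ≤ N + 5 / 4 * (z * (4 / 3 * (S + N))) := by gcongr
    _ = N + 5 / 3 * (z * S + z * N) := by ring
    _ ≤ z * S * N + 5 / 3 * (z * S + z * S * N) := by
        gcongr
        exact le_mul_of_one_le_left N.cast_nonneg (hz.trans hzS)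
    _ ≤ z * S * (3 * N + 2) := by nlinarith [N.cast_nonneg (α := ℝ)]
    _ ≤ z * S * z := by gcongr
    _ = z * z * S := by ring

theorem vanishingIndex_le (hb : IsBulk η N K L) {r : ℝ} (hr : |r - 1| / r ≤ η / 2)
    (hN : 2 ≤ η * N) : vanishingIndex r N ≤ K := by
  have hle := mul_le_mul_of_nonneg_right hr (N.cast_nonneg (α := ℝ))
  rw [vanishingIndex]
  linarith [hb.lt_lower_add_one]

theorem le_abs_habiroProd_mul_bulkSum (hb : IsBulk η N K L) {γ δ r : ℝ}
    (hη : 2 * (η + Real.negMulLog η) ≤ δ) (hδ0 : 0 ≤ δ) (hδ1 : δ ≤ 1 / 2)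
    (hr : |r - 1| ≤ 1 / 4) (hrδ : 4 * |r - 1| ≤ δ * η ^ 2) (hγ : 0 ≤ γ)
    (hv : vanishingIndex r N ≤ K)
    (hfract : Int.fract (vanishingIndex r N) ∈ Set.Icc γ (1 - γ)) :
    γ ^ 2 * Real.exp (-(3 * δ * N)) * bulkSum 1 N K L ≤ |habiroProd r N K * bulkSum r N K L| := by
  have hδ1' : δ ≤ 1 := by linarith
  rw [abs_mul, abs_of_nonneg (hb.bulkSum_nonneg hrδ hδ0 hδ1')]
  calc γ ^ 2 * Real.exp (-(3 * δ * N)) * bulkSum 1 N K L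
      = γ ^ 2 * Real.exp (-(δ * N)) * (Real.exp (-(2 * δ * N)) * bulkSum 1 N K L) := by
        rw [show -(3 * δ * N) = -(δ * N) + -(2 * δ * N) by ring, Real.exp_add]
        ring
    _ ≤ γ ^ 2 * Real.exp (-(δ * N)) * ((1 - δ) ^ N * bulkSum 1 N K L) := by
        gcongr
        · exact bulkSum_one_nonneg N K L
        · exact exp_neg_two_mul_le_one_sub_pow hδ0 hδ1 N
    _ ≤ |habiroProd r N K| * bulkSum r N K L :=
        mul_le_mul (le_abs_habiroProd hr hb.eta_pos (by linarith [hb.eta_le]) hη hγ hb.pos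
          hb.lower_le hv hfract) (hb.pow_mul_bulkSum_one_le hrδ hδ0 hδ1')
          (mul_nonneg (pow_nonneg (by linarith) _) (bulkSum_one_nonneg N K L)) (abs_nonneg _)

theorem le_abs_habiroSum (hb : IsBulk η N K L) {γ δ r : ℝ}
    (hη : 2 * (η + Real.negMulLog η) ≤ δ) (hδ0 : 0 ≤ δ) (hδ1 : 5 * δ ≤ Real.log 2 / 12)
    (hr : |r - 1| ≤ 1 / 1280) (hrδ : 4 * |r - 1| ≤ δ * η ^ 2) (hγ : 0 ≤ γ)
    (hv : vanishingIndex r N ≤ K)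
    (hfract : Int.fract (vanishingIndex r N) ∈ Set.Icc γ (1 - γ))
    (hN : 2 * N ≤ Real.exp (δ * N)) (hγN : 20 ≤ 3 * γ ^ 2 * Real.exp (δ * N)) :
    Real.exp (-(4 * δ * N)) * habiroSum 1 N ≤ |habiroSum r N| := by
  have hδ2 : δ ≤ 1 / 2 := by linarith [Real.log_two_lt_d9]
  have hsplit := abs_sub_abs_le_abs_sub (habiroProd r N K * bulkSum r N K L) (habiroSum r N)
  rw [abs_sub_comm] at hsplit
  have herror := hb.abs_habiroSum_sub_le hr hrδ hδ0 (by linarith)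
  have hmain := hb.le_abs_habiroProd_mul_bulkSum hη hδ0 hδ2 (by linarith) hrδ hγ hv hfract
  have hS : Real.exp (5 * δ * N) ≤ habiroSum 1 N :=
    (Real.exp_le_exp.mpr (mul_le_mul_of_nonneg_right hδ1 N.cast_nonneg)).trans
      (exp_le_habiroSum_one (by linarith [hb.large]))
  set S := habiroSum 1 N
  have hw : Real.exp (δ * N) ≤ Real.exp (-(4 * δ * N)) * S := by
    rw [show δ * N = -(4 * δ * N) + 5 * δ * N by ring, Real.exp_add]
    gcongr
  have hwS : Real.exp (-(4 * δ * N)) * S ≤ S :=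
    mul_le_of_le_one_left ((Real.exp_pos _).le.trans hS)
      (Real.exp_le_one_iff.mpr (neg_nonpos.mpr (by positivity)))
  have hbulk : 2 / 5 * S ≤ bulkSum 1 N K L := by linarith [hb.le_bulkSum_one]
  have hlarge : 8 / 3 * (Real.exp (-(4 * δ * N)) * S) ≤ |habiroProd r N K * bulkSum r N K L| :=
    calc 8 / 3 * (Real.exp (-(4 * δ * N)) * S)
        ≤ 2 / 5 * (γ ^ 2 * Real.exp (δ * N)) * (Real.exp (-(4 * δ * N)) * S) :=
          mul_le_mul_of_nonneg_right (by linarith) ((Real.exp_pos _).le.trans hw)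
      _ = γ ^ 2 * Real.exp (-(3 * δ * N)) * (2 / 5 * S) := by
          rw [show -(3 * δ * N) = δ * N + -(4 * δ * N) by ring, Real.exp_add]
          ring
      _ ≤ γ ^ 2 * Real.exp (-(3 * δ * N)) * bulkSum 1 N K L := by gcongr
      _ ≤ |habiroProd r N K * bulkSum r N K L| := hmain
  linarith

end IsBulk

theorem eventually_abs_habiroSum_le {ε : ℝ} (hε : 0 < ε) :
    ∀ᶠ r : ℝ in 𝓝 1, ∀ᶠ N : ℕ in atTop, |habiroSum r N| ≤ Real.exp (ε * N) * habiroSum 1 N := by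
  set δ := min (ε / 4) 1
  have hδ0 : 0 < δ := lt_min (by positivity) one_pos
  have hδε : 4 * δ ≤ ε := by linarith [min_le_left (ε / 4) 1]
  obtain ⟨η, hη0, hη1, hη⟩ := exists_add_negMulLog_le hδ0
  filter_upwards [eventually_abs_sub_le (show (0 : ℝ) < 1 / 1280 by norm_num) 1,
    eventually_abs_sub_le (show 0 < δ * η ^ 2 / 4 by positivity) 1] with r hr hrδ
  filter_upwards [eventually_isBulk hη0 hη1,
    eventually_mul_add_le_exp_mul (show 0 < 2 * δ by positivity) 3 2] with N ⟨K, L, hb⟩ hN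
  refine (hb.abs_habiroSum_le hη hδ0.le (min_le_right _ _) hr (by linarith) hN).trans ?_
  have hS := one_le_habiroSum_one hb.pos
  gcongr

theorem eventually_le_abs_habiroSum {ε : ℝ} (hε : 0 < ε) :
    ∀ᶠ r : ℝ in 𝓝[≠] 1, ∀ᶠ N : ℕ in atTop,
      Int.fract (vanishingIndex r N) ∈ Set.Icc (|r - 1| / r / 4) (1 - |r - 1| / r / 4) →
        Real.exp (-(ε * N)) * habiroSum 1 N ≤ |habiroSum r N| := by
  set δ := min (ε / 4) (Real.log 2 / 60)
  have hδ0 : 0 < δ := lt_min (by positivity) (by positivity)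
  have hδε : 4 * δ ≤ ε := by linarith [min_le_left (ε / 4) (Real.log 2 / 60)]
  have hδ1 : 5 * δ ≤ Real.log 2 / 12 := by linarith [min_le_right (ε / 4) (Real.log 2 / 60)]
  obtain ⟨η, hη0, hη1, hη⟩ := exists_add_negMulLog_le hδ0
  filter_upwards [nhdsWithin_le_nhds
      (eventually_abs_sub_le (show (0 : ℝ) < 1 / 1280 by norm_num) 1),
    nhdsWithin_le_nhds (eventually_abs_sub_le (show 0 < δ * η ^ 2 / 4 by positivity) 1),
    nhdsWithin_le_nhds (eventually_abs_sub_le (show 0 < η / 4 by positivity) 1),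
    self_mem_nhdsWithin] with r hr hrδ hrη hr1
  have hr_half : 1 / 2 ≤ r := by linarith [(abs_le.mp hr).1]
  have hr0 : 0 < r := by linarith
  have hratio : |r - 1| / r ≤ η / 2 := by
    rw [div_le_iff₀ hr0]
    nlinarith
  have hγ : 0 < |r - 1| / r / 4 := by
    have := abs_pos.mpr (sub_ne_zero.mpr hr1)
    positivity
  set γ := |r - 1| / r / 4
  filter_upwards [eventually_isBulk hη0 hη1, eventually_mul_add_le_exp_mul hδ0 2 0,
    eventually_mul_add_le_exp_mul hδ0 0 (20 / (3 * γ ^ 2)),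
    (tendsto_natCast_atTop_atTop.const_mul_atTop hη0).eventually_ge_atTop 2]
    with N ⟨K, L, hb⟩ hN hγN hηN hfract
  rw [add_zero] at hN
  rw [zero_mul, zero_add, div_le_iff₀' (by positivity)] at hγN
  refine le_trans ?_ (hb.le_abs_habiroSum hη hδ0.le hδ1 hr (by linarith) hγ.le
    (hb.vanishingIndex_le hratio hηN) hfract hN hγN)
  have hS := one_le_habiroSum_one hb.pos
  gcongr

theorem fract_mem_Icc_or_fract_add_mem_Icc {a : ℝ} (ha0 : 0 < a) (ha1 : a ≤ 1 / 4) (x : ℝ) :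
    Int.fract x ∈ Set.Icc (a / 4) (1 - a / 4) ∨
      Int.fract (x + a) ∈ Set.Icc (a / 4) (1 - a / 4) := by
  have hfract0 := Int.fract_nonneg x
  have hfract1 := Int.fract_lt_one x
  have hx := Int.floor_add_fract x
  rcases lt_or_ge (Int.fract x) (a / 4) with hlow | hlow
  · have hshift : Int.fract (x + a) = Int.fract x + a :=
      Int.fract_eq_iff.mpr ⟨by linarith, by linarith, ⌊x⌋, by linarith⟩
    right
    rw [hshift]
    constructor <;> linarith
  rcases le_or_gt (Int.fract x) (1 - a / 4) with hhigh | hhigh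
  · exact Or.inl ⟨hlow, hhigh⟩
  · have hshift : Int.fract (x + a) = Int.fract x + a - 1 :=
      Int.fract_eq_iff.mpr ⟨by linarith, by linarith, ⌊x⌋ + 1, by push_cast; linarith⟩
    right
    rw [hshift]
    constructor <;> linarith

theorem eventually_exists_le_abs_habiroSum {ε : ℝ} (hε : 0 < ε) :
    ∀ᶠ r : ℝ in 𝓝[≠] 1, ∀ᶠ N : ℕ in atTop, ∃ M, N ≤ M ∧ M ≤ N + 1 ∧
      Real.exp (-(ε * M) - 2) * habiroSum 1 N ≤ |habiroSum r M| := by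
  filter_upwards [eventually_le_abs_habiroSum hε,
    nhdsWithin_le_nhds (eventually_abs_sub_le (show (0 : ℝ) < 1 / 8 by norm_num) 1),
    self_mem_nhdsWithin] with r hle hr hr1
  have hr_half : 1 / 2 ≤ r := by linarith [(abs_le.mp hr).1]
  have hr0 : 0 < r := by linarith
  have hstep0 : 0 < |r - 1| / r := div_pos (abs_pos.mpr (sub_ne_zero.mpr hr1)) hr0
  have hstep1 : |r - 1| / r ≤ 1 / 4 := by
    rw [div_le_iff₀ hr0]
    linarith
  filter_upwards [hle, (tendsto_add_atTop_nat 1).eventually hle, eventually_gt_atTop 0]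
    with N hN hsucc hN0
  have hshift : vanishingIndex r N + |r - 1| / r = vanishingIndex r (N + 1) := by
    rw [vanishingIndex, vanishingIndex, Nat.cast_succ, mul_add_one]
  have hS := one_le_habiroSum_one hN0
  rcases fract_mem_Icc_or_fract_add_mem_Icc hstep0 hstep1 (vanishingIndex r N) with hmem | hmem
  · refine ⟨N, le_rfl, N.le_succ, le_trans ?_ (hN hmem)⟩
    gcongr
    linarith
  · refine ⟨N + 1, N.le_succ, le_rfl, le_trans ?_ (hsucc (hshift ▸ hmem))⟩
    rw [sub_eq_add_neg, Real.exp_add, mul_assoc]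
    gcongr
    exact exp_neg_two_mul_habiroSum_one_le hN0

/-- The sequence whose upper limit is `growthRate r`. -/
def logTerm (r : ℝ) (N : ℕ) : EReal :=
  ENNReal.log ‖coloredJones N figureEight
    (Complex.exp (2 * (Real.pi : ℂ) * (r : ℂ) * Complex.I / (N : ℂ)))‖ₑ / (N : EReal)

theorem logTerm_eq {r : ℝ} {N : ℕ} (hN : 2 * |r| < N) :
    logTerm r N = ENNReal.log (ENNReal.ofReal |habiroSum r N|) / N := by
  rw [logTerm, coloredJones_figureEight_exp hN, ← ofReal_norm, Complex.norm_real,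
    Real.norm_eq_abs]

theorem coe_mul_natCast_eq_log (c : ℝ) (N : ℕ) :
    (c : EReal) * N = ENNReal.log (ENNReal.ofReal (Real.exp (c * N))) := by
  rw [ENNReal.log_ofReal_of_pos (Real.exp_pos _), Real.log_exp, EReal.coe_mul]
  rfl

theorem logTerm_le_iff {r c : ℝ} {N : ℕ} (hN : 2 * |r| < N) :
    logTerm r N ≤ c ↔ |habiroSum r N| ≤ Real.exp (c * N) := by
  have hN0 : (0 : ℝ) < N := lt_of_le_of_lt (by positivity) hN
  rw [logTerm_eq hN, EReal.div_le_iff_le_mul (by exact_mod_cast hN0) (EReal.natCast_ne_top N),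
    mul_comm, coe_mul_natCast_eq_log, ENNReal.log_le_log_iff,
    ENNReal.ofReal_le_ofReal_iff (Real.exp_pos _).le]

theorem le_logTerm_iff {r c : ℝ} {N : ℕ} (hN : 2 * |r| < N) :
    c ≤ logTerm r N ↔ Real.exp (c * N) ≤ |habiroSum r N| := by
  have hN0 : (0 : ℝ) < N := lt_of_le_of_lt (by positivity) hN
  rw [logTerm_eq hN, EReal.le_div_iff_mul_le (by exact_mod_cast hN0) (EReal.natCast_ne_top N),
    coe_mul_natCast_eq_log, ENNReal.log_le_log_iff, ENNReal.ofReal_le_ofReal_iff (abs_nonneg _)]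

theorem eventually_two_mul_abs_lt_natCast (r : ℝ) : ∀ᶠ N : ℕ in atTop, 2 * |r| < N :=
  tendsto_natCast_atTop_atTop.eventually_gt_atTop _

theorem growthRate_le {r c : ℝ} (h : ∀ᶠ N : ℕ in atTop, |habiroSum r N| ≤ Real.exp (c * N)) :
    growthRate r ≤ c := by
  refine limsup_le_of_le (f := atTop) (u := logTerm r) (by isBoundedDefault) ?_
  filter_upwards [h, eventually_two_mul_abs_lt_natCast r] with N hN hr
  exact (logTerm_le_iff hr).mpr hN

theorem le_growthRate {r c : ℝ} (h : ∃ᶠ N : ℕ in atTop, Real.exp (c * N) ≤ |habiroSum r N|) :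
    c ≤ growthRate r := by
  refine le_limsup_of_frequently_le (f := atTop) (u := logTerm r) ?_ (by isBoundedDefault)
  exact (h.and_eventually (eventually_two_mul_abs_lt_natCast r)).mono
    fun N hN => (le_logTerm_iff hN.2).mpr hN.1

theorem eventually_le_of_growthRate_lt {r c : ℝ} (h : growthRate r < c) :
    ∀ᶠ N : ℕ in atTop, |habiroSum r N| ≤ Real.exp (c * N) := by
  have hlt : ∀ᶠ N : ℕ in atTop, logTerm r N < c :=
    eventually_lt_of_limsup_lt (f := atTop) (u := logTerm r) h (by isBoundedDefault)
  filter_upwards [hlt, eventually_two_mul_abs_lt_natCast r] with N hN hr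
  exact (logTerm_le_iff hr).mp hN.le

theorem frequently_le_of_lt_growthRate {r c : ℝ} (h : c < growthRate r) :
    ∃ᶠ N : ℕ in atTop, Real.exp (c * N) ≤ |habiroSum r N| := by
  have hlt : ∃ᶠ N : ℕ in atTop, c < logTerm r N :=
    frequently_lt_of_lt_limsup (f := atTop) (u := logTerm r) (by isBoundedDefault) h
  exact (hlt.and_eventually (eventually_two_mul_abs_lt_natCast r)).mono
    fun N hN => (le_logTerm_iff hN.2).mp hN.1.le

theorem growthRate_one_nonneg : 0 ≤ growthRate 1 := by
  refine le_growthRate (c := 0) (Eventually.frequently ?_)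
  filter_upwards [eventually_gt_atTop 0] with N hN
  simpa using (one_le_habiroSum_one hN).trans (le_abs_self _)

theorem growthRate_one_le : growthRate 1 ≤ ((1 + Real.log 4 : ℝ) : EReal) := by
  refine growthRate_le ?_
  filter_upwards [eventually_gt_atTop 0] with N hN
  rw [abs_of_nonneg (zero_le_one.trans (one_le_habiroSum_one hN))]
  calc habiroSum 1 N ≤ N * 4 ^ N := habiroSum_one_le N
    _ ≤ Real.exp N * 4 ^ N := by
        gcongr
        linarith [Real.add_one_le_exp (N : ℝ)]
    _ = Real.exp ((1 + Real.log 4) * N) := by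
        rw [add_mul, one_mul, Real.exp_add, ← Real.rpow_def_of_pos (by norm_num),
          Real.rpow_natCast]

theorem eventually_growthRate_lt {b : EReal} (hb : growthRate 1 < b) :
    ∀ᶠ r in 𝓝 (1 : ℝ), growthRate r < b := by
  obtain ⟨c, hc, hcb⟩ := EReal.lt_iff_exists_real_btwn.mp hb
  obtain ⟨d, hcd, hdb⟩ := EReal.lt_iff_exists_real_btwn.mp hcb
  filter_upwards [eventually_abs_habiroSum_le (sub_pos.mpr (EReal.coe_lt_coe_iff.mp hcd))]
    with r hr
  refine (growthRate_le ?_).trans_lt hdb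
  filter_upwards [hr, eventually_le_of_growthRate_lt hc] with N hN hone
  calc |habiroSum r N| ≤ Real.exp ((d - c) * N) * habiroSum 1 N := hN
    _ ≤ Real.exp ((d - c) * N) * Real.exp (c * N) := by
        gcongr
        exact (le_abs_self _).trans hone
    _ = Real.exp (d * N) := by
        rw [← Real.exp_add]
        ring_nf

theorem eventually_lt_growthRate {a : EReal} (ha : a < growthRate 1) :
    ∀ᶠ r in 𝓝[≠] (1 : ℝ), a < growthRate r := by
  obtain ⟨d, had, hd⟩ := EReal.lt_iff_exists_real_btwn.mp ha
  obtain ⟨c, hdc, hc⟩ := EReal.lt_iff_exists_real_btwn.mp hd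
  obtain ⟨ε, hε, rfl⟩ : ∃ ε > 0, c = d + 2 * ε :=
    ⟨(c - d) / 2, half_pos (sub_pos.mpr (EReal.coe_lt_coe_iff.mp hdc)), by ring⟩
  filter_upwards [eventually_exists_le_abs_habiroSum hε] with r hr
  refine had.trans_le (le_growthRate (frequently_atTop.mpr fun n => ?_))
  obtain ⟨N, hone, ⟨⟨M, hNM, hMN, hM⟩, hN0, hnN⟩, hlarge⟩ :=
    ((frequently_le_of_lt_growthRate hc).and_eventually
      ((hr.and ((eventually_gt_atTop 0).and (eventually_ge_atTop n))).and
        ((tendsto_natCast_atTop_atTop.const_mul_atTop hε).eventually_ge_atTop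
          (2 + |d + 2 * ε|)))).exists
  refine ⟨M, hnN.trans hNM, ?_⟩
  rw [abs_of_nonneg (zero_le_one.trans (one_le_habiroSum_one hN0))] at hone
  have hNM' : (N : ℝ) ≤ M := Nat.cast_le.mpr hNM
  have hMN' : (M : ℝ) ≤ N + 1 := by exact_mod_cast hMN
  have hstep : (d + 2 * ε) * (M - N) ≤ |d + 2 * ε| :=
    (mul_le_mul_of_nonneg_right (le_abs_self _) (sub_nonneg.mpr hNM')).trans
      (mul_le_of_le_one_right (abs_nonneg _) (by linarith))
  have hgain : 2 + |d + 2 * ε| ≤ ε * M := hlarge.trans (mul_le_mul_of_nonneg_left hNM' hε.le)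
  calc Real.exp (d * M) ≤ Real.exp (-(ε * M) - 2) * Real.exp ((d + 2 * ε) * N) := by
        rw [← Real.exp_add, Real.exp_le_exp]
        linarith
    _ ≤ Real.exp (-(ε * M) - 2) * habiroSum 1 N := by gcongr
    _ ≤ |habiroSum r M| := hM

end ColoredJones

end

/-- The limsup growth rate of the colored Jones polynomials of the figure-eight knot at
`exp(2 π r √-1 / N)` is finite at `r = 1`, and its limit as `r → 1` is its value at `r = 1`. -/
theorem mainTheorem2 :
    ColoredJones.growthRate 1 ≠ ⊥ ∧ ColoredJones.growthRate 1 ≠ ⊤ ∧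
      Tendsto ColoredJones.growthRate (𝓝[≠] (1 : ℝ)) (𝓝 (ColoredJones.growthRate 1)) := by
  refine ⟨(EReal.bot_lt_zero.trans_le ColoredJones.growthRate_one_nonneg).ne',
    (ColoredJones.growthRate_one_le.trans_lt (EReal.coe_lt_top _)).ne, tendsto_order.mpr ⟨?_, ?_⟩⟩
  · exact fun a ha => ColoredJones.eventually_lt_growthRate ha
  · exact fun b hb => nhdsWithin_le_nhds (ColoredJones.eventually_growthRate_lt hb)
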